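/- Let $p$ be an odd prime, $\omega = e^{2\pi i/p}$, $\mathbb{Z}_p=\mathbb{Z}/p\mathbb{Z}$, and write $|k\rangle = |k{:}Z\rangle$ ($k\in\mathbb{Z}_p$) for the computational basis of the qupit space $\mathbb{C}^p$ and $|k{:}X\rangle = p^{-1/2}\sum_{m\in\mathbb{Z}_p}\omega^{km}|m\rangle$. The space of $n$ qupits is $(\mathbb{C}^p)^{\otimes n}$. **Stabiliser operations.** Let $X|m\rangle=|m+1\rangle$ and $Z|m\rangle=\omega^m|m\rangle$, and let $\mathscr{P}_n$ be the group of operators $\omega^k\bigotimes_{j=1}^n X^{a_j}Z^{b_j}$ with $k,a_j,b_j\in\mathbb{Z}_p$. A unitary $U$ on $n$ qupits is Clifford if $UPU^\dagger\in\mathscr{P}_n$ for all $P\in\mathscr{P}_n$. Let $\mathbb{P}_p=\{(-1)^s\omega^t\mid s,t\in\mathbb{Z}\}$ if $p\equiv1 \bmod 4$ and $\mathbb{P}_p=\{i^s\omega^t\mid s,t\in\mathbb{Z}\}$ if $p\equiv3\bmod 4$, and let $\mathbb{G}_p=\{0\}\cup\{\sqrt{p^r}\,\lambda\mid r\in\mathbb{Z},\lambda\in\mathbb{P}_p\}$.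 The reduced Clifford operators on $n$ qupits are the $\lambda U$ with $\lambda\in\mathbb{P}_p$ and $U$ Clifford with $\det U=1$. A *stabiliser operation* $C:(\mathbb{C}^p)^{\otimes m}\to(\mathbb{C}^p)^{\otimes n}$ is a linear map that is obtained by composition and tensor product from identities, swaps, the state $|0\rangle$, the effect $\langle 0|$, reduced Clifford operators and scalars in $\mathbb{G}_p$, and all of whose matrix entries $\langle x|C|y\rangle$ in the computational basis lie in $\mathbb{G}_p$. **Diagrams.** The diagrams of $\mathsf{ZX}_p^{\mathrm{Stab}}$ are generated under sequential and parallel composition by the identities on $n$ wires and by the generators below, where $x,y\in\mathbb{Z}_p$ are labels. The interpretation $[\![-]\!]$ sends sequential composition to composition of linear maps, parallel composition to the tensor product, identities to identities, and the generators to the following maps (sums over $\mathbb{Z}_p$, with $2^{-1}$ taken in $\mathbb{Z}_p$): - green unit $0\to1$: $\sum_k\omega^{2^{-1}(xk+yk^2)}|k{:}Z\rangle$; green counit $1\to0$: $\sum_k\omega^{2^{-1}(xk+yk^2)}\langle k{:}Z|$; green $1\to 2$: $\sum_k|k,k{:}Z\rangle\langle k{:}Z|$; green $2\to1$: $\sum_k|k{:}Z\rangle\langle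 k,k{:}Z|$; green $1\to1$: $\sum_k|k{:}Z\rangle\langle k{:}Z|$; - red unit $0\to1$: $\sum_k\omega^{2^{-1}(xk+yk^2)}|{-k}{:}X\rangle$; red counit $1\to0$: $\sum_k\omega^{2^{-1}(xk+yk^2)}\langle k{:}X|$; red $1\to 2$: $\sum_k|{-k},{-k}{:}X\rangle\langle k{:}X|$; red $2\to1$: $\sum_k|{-k}{:}X\rangle\langle k,k{:}X|$; antipode $1\to1$: $\sum_k|{-k}{:}X\rangle\langle k{:}X|$; - Hadamard $1\to1$: $\sum_k|k{:}X\rangle\langle k{:}Z|$; cup $0\to2$: $\sum_k|k,k{:}Z\rangle$; cap $2\to0$: $\sum_k\langle k,k{:}Z|$; braid $2\to2$: $\sum_{k,\ell}|k,\ell{:}Z\rangle\langle\ell,k{:}Z|$; $\star:0\to0$: $-1$. **Theorem (Universality).** For all $m,n\in\mathbb{N}$, the interpretation of every diagram $m\to n$ is a stabiliser operation, and for every stabiliser operation $C:(\mathbb{C}^p)^{\otimes m}\to(\mathbb{C}^p)^{\otimes n}$ there is a diagram $D:m\to n$ with $[\![D]\!]=C$. That is, the interpretation co-restricts to the category $\mathsf{Stab}_p$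 of stabiliser operations, and this co-restriction is full. -/

import Mathlib

noncomputable section

namespace QupitZX

/-- The computational basis of `n` qupits. -/
abbrev Basis (p n : ℕ) : Type := Fin n → ZMod p

/-- Linear maps from `m` qupits to `n` qupits, as matrices in the computational basis:
the entry at `(x, y)` is the amplitude `⟨x|M|y⟩`. -/
abbrev Op (p m n : ℕ) : Type := Matrix (Basis p n) (Basis p m) ℂ

section Basics

variable (p : ℕ) [Fact p.Prime]

/-- `ω = exp(2πi/p)`. -/
def omega : ℂ := Complex.exp (2 * Real.pi * Complex.I / p)

/-- `ω ^ a` for an exponent `a` modulo `p`. -/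
def omegaPow (a : ZMod p) : ℂ := omega p ^ a.val

/-- Exponents of `ω` may be computed modulo `p`: `omegaPow` is the standard additive character. -/
theorem omegaPow_eq_stdAddChar (a : ZMod p) : omegaPow p a = ZMod.stdAddChar a := by
  rw [omegaPow, omega, ← Complex.exp_nat_mul, ZMod.stdAddChar_apply, ZMod.toCircle_apply]
  congr 1
  ring

/-- The group of phases `ℙ_p`: `(-1)^s ω^t` if `p ≡ 1 mod 4`, and `i^s ω^t` if `p ≡ 3 mod 4`. -/
def phaseGroup : Set ℂ :=
  {z | ∃ s t : ℤ, z = (if p % 4 = 1 then -1 else Complex.I) ^ s * omega p ^ t}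

/-- The monoid of scalars `𝔾_p = {0} ∪ {√(p^r) λ | r ∈ ℤ, λ ∈ ℙ_p}`. -/
def scalarMonoid : Set ℂ :=
  {z | z = 0 ∨ ∃ r : ℤ, ∃ l ∈ phaseGroup p, z = (Real.sqrt ((p : ℝ) ^ r) : ℂ) * l}

/-- The vector `|k : Z⟩ = |k⟩`. -/
def ketZ (k : ZMod p) : ZMod p → ℂ := Pi.single k 1

/-- The vector `|k : X⟩ = H|k⟩ = p^{-1/2} ∑ₘ ω^{km} |m⟩`. -/
def ketX (k : ZMod p) : ZMod p → ℂ := fun m => omegaPow p (k * m) / (Real.sqrt p : ℂ)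

variable {p}

/-- The `n`-fold tensor power `v ⊗ ⋯ ⊗ v` of a one-qupit vector. -/
def ketPow (n : ℕ) (v : ZMod p → ℂ) : Basis p n → ℂ := fun x => ∏ i, v (x i)

/-- The operator `|u⟩⟨v|`. -/
def dyad {m n : ℕ} (u : Basis p n → ℂ) (v : Basis p m → ℂ) : Op p m n :=
  Matrix.vecMulVec u (star v)

/-- The tensor product of two operators. -/
def tensorOp {m n m' n' : ℕ} (A : Op p m n) (B : Op p m' n') : Op p (m + m') (n + n') :=
  Matrix.of fun x y =>
    A (fun i => x (Fin.castAdd n' i)) (fun i => y (Fin.castAdd m' i)) *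
      B (fun i => x (Fin.natAdd n i)) (fun i => y (Fin.natAdd m i))

variable (p) in
/-- The swap `∑_{k,l} |k,l⟩⟨l,k|` of two qupits. -/
def swapOp : Op p 2 2 :=
  ∑ k : ZMod p, ∑ l : ZMod p, dyad (Pi.single ![k, l] 1) (Pi.single ![l, k] 1)

/-- A scalar, as an operator from zero qupits to zero qupits. -/
def scalarOp (z : ℂ) : Op p 0 0 := Matrix.of fun _ _ => z

end Basics

section Stabiliser

variable {p : ℕ} [Fact p.Prime]

/-- The Pauli operator `ω^k X^{a₁}Z^{b₁} ⊗ ⋯ ⊗ X^{aₙ}Z^{bₙ}`, where `X|m⟩ = |m+1⟩` and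
`Z|m⟩ = ω^m|m⟩`; it maps `|y⟩` to `ω^{k + b·y} |y + a⟩`. -/
def pauli {n : ℕ} (k : ZMod p) (a b : Basis p n) : Op p n n :=
  Matrix.of fun x y => if x = y + a then omegaPow p (k + b ⬝ᵥ y) else 0

variable (p) in
/-- The generalised Pauli group on `n` qupits. -/
def pauliGroup (n : ℕ) : Set (Op p n n) := {P | ∃ k a b, P = pauli k a b}

/-- The Clifford operators: the unitaries `U` such that `U P U†` is Pauli for every Pauli `P`. -/
def IsClifford {n : ℕ} (U : Op p n n) : Prop :=
  U ∈ Matrix.unitaryGroup (Basis p n) ℂ ∧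
    ∀ P ∈ pauliGroup p n, U * P * U.conjTranspose ∈ pauliGroup p n

variable (p) in
/-- The reduced Clifford operators `λU`, with `λ ∈ ℙ_p` and `U` Clifford and special unitary. -/
def reducedClifford (n : ℕ) : Set (Op p n n) :=
  {M | ∃ l ∈ phaseGroup p, ∃ U : Op p n n, IsClifford U ∧ U.det = 1 ∧ M = l • U}

/-- The operators obtained by sequential and parallel composition (including identities and swaps)
from the computational basis state `|0⟩`, the effect `⟨0|`, reduced Clifford operators, and
scalars in `𝔾_p`. -/
inductive Generated : {m n : ℕ} → Op p m n → Prop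
  | id (n : ℕ) : Generated (1 : Op p n n)
  | swap : Generated (swapOp p)
  | state : Generated (dyad (ketPow 1 (ketZ p 0)) (ketPow 0 (ketZ p 0)) : Op p 0 1)
  | effect : Generated (dyad (ketPow 0 (ketZ p 0)) (ketPow 1 (ketZ p 0)) : Op p 1 0)
  | clifford {n : ℕ} (U : Op p n n) (hU : U ∈ reducedClifford p n) : Generated U
  | scalar (z : ℂ) (hz : z ∈ scalarMonoid p) : Generated (scalarOp z : Op p 0 0)
  | comp {m n k : ℕ} (A : Op p m n) (B : Op p n k) (hA : Generated A) (hB : Generated B) :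
      Generated (B * A)
  | tensor {m n m' n' : ℕ} (A : Op p m n) (B : Op p m' n')
      (hA : Generated A) (hB : Generated B) : Generated (tensorOp A B)

/-- The morphisms of `Stab_p`: the operators built from the generators above, with scalars in
`𝔾_p`, that is, all of whose amplitudes `⟨x|C|y⟩` belong to `𝔾_p`.

The condition on amplitudes is not automatic. The special unitary Clifford operators include the
scalar `exp(2πi/p^n)` on `n` qupits, which is outside `ℙ_p` as soon as `n ≥ 2`. -/
def IsStabiliserOperation {m n : ℕ} (C : Op p m n) : Prop :=
  Generated C ∧ ∀ x y, C x y ∈ scalarMonoid p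

end Stabiliser

/-- The diagrams with `m` inputs and `n` outputs. The identity on `n` wires is the empty diagram
for `n = 0` and the plain wire for `n = 1`. -/
inductive Diagram (p : ℕ) : ℕ → ℕ → Type
  | id (n : ℕ) : Diagram p n n
  | braid : Diagram p 2 2
  | cup : Diagram p 0 2
  | cap : Diagram p 2 0
  | hadamard : Diagram p 1 1
  | star : Diagram p 0 0
  | greenId : Diagram p 1 1
  | greenUnit (x y : ZMod p) : Diagram p 0 1
  | greenCounit (x y : ZMod p) : Diagram p 1 0
  | greenMult : Diagram p 2 1
  | greenComult : Diagram p 1 2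
  | antipode : Diagram p 1 1
  | redUnit (x y : ZMod p) : Diagram p 0 1
  | redCounit (x y : ZMod p) : Diagram p 1 0
  | redMult : Diagram p 2 1
  | redComult : Diagram p 1 2
  | comp {m n k : ℕ} (D : Diagram p m n) (E : Diagram p n k) : Diagram p m k
  | tensor {m n m' n' : ℕ} (D : Diagram p m n) (E : Diagram p m' n') :
      Diagram p (m + m') (n + n')

section Interpretation

variable {p : ℕ} [Fact p.Prime]

/-- The phase `ω^{2⁻¹(xk + yk²)}` of a spider with label `(x, y)`. -/
def spiderPhase (x y k : ZMod p) : ℂ := omegaPow p (2⁻¹ * (x * k + y * k ^ 2))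

/-- The map `∑ₖ ω^{2⁻¹(xk + yk²)} |k:Z⟩^{⊗n} ⟨k:Z|^{⊗m}`. -/
def greenOp (m n : ℕ) (x y : ZMod p) : Op p m n :=
  ∑ k : ZMod p, spiderPhase x y k • dyad (ketPow n (ketZ p k)) (ketPow m (ketZ p k))

/-- The map `∑ₖ ω^{2⁻¹(xk + yk²)} |-k:X⟩^{⊗n} ⟨k:X|^{⊗m}`. -/
def redOp (m n : ℕ) (x y : ZMod p) : Op p m n :=
  ∑ k : ZMod p, spiderPhase x y k • dyad (ketPow n (ketX p (-k))) (ketPow m (ketX p k))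

/-- The standard interpretation of diagrams. -/
def interp : {m n : ℕ} → Diagram p m n → Op p m n
  | _, _, .id _ => 1
  | _, _, .braid => swapOp p
  | _, _, .cup => greenOp 0 2 0 0
  | _, _, .cap => greenOp 2 0 0 0
  | _, _, .hadamard => ∑ k : ZMod p, dyad (ketPow 1 (ketX p k)) (ketPow 1 (ketZ p k))
  | _, _, .star => scalarOp (-1)
  | _, _, .greenId => greenOp 1 1 0 0
  | _, _, .greenUnit x y => greenOp 0 1 x y
  | _, _, .greenCounit x y => greenOp 1 0 x y
  | _, _, .greenMult => greenOp 2 1 0 0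
  | _, _, .greenComult => greenOp 1 2 0 0
  | _, _, .antipode => redOp 1 1 0 0
  | _, _, .redUnit x y => redOp 0 1 x y
  | _, _, .redCounit x y => redOp 1 0 x y
  | _, _, .redMult => redOp 2 1 0 0
  | _, _, .redComult => redOp 1 2 0 0
  | _, _, .comp D E => interp E * interp D
  | _, _, .tensor D E => tensorOp (interp D) (interp E)

end Interpretation

end QupitZX

end

/-
A linear map between qupit spaces is a stabiliser operation, and equally the interpretation of a
diagram, exactly when its amplitudes have the form `c ∑_w ω^{q(x,y,w)}` with `c ∈ 𝔾_p` and `q` a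
polynomial of degree at most two in the labels `x`, `y` and in auxiliary labels `w`. Such maps are
closed under composition and tensor product, and diagonalising `q` reduces their amplitudes to
products of Gauss sums, which lie in `𝔾_p`.

Conversely, such a map is a scalar times a diagonal operator `∑_z ω^{q(z)} |z⟩⟨z|`, with copies of
`∑_k |k⟩` plugged into some of its inputs and copies of `∑_k ⟨k|` into some of its outputs. The
diagonal operator is Clifford. It is also the interpretation of a diagram: swaps bring any two
wires next to each other, and `ω^{y₀y₁}` is realised by a Hadamard gate between two green spiders.

Determinants are no obstruction to generating a Clifford `U` with nonzero `⟨0|U|0⟩ ∈ 𝔾_p`: up to a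
scalar, it is obtained from `U ⊗ U†`, which has determinant one, by projecting the second factor
onto `|0⟩`. In the other direction, any Clifford `U` acts on Pauli operators by linear maps with a
quadratic phase, so that `U` is of the above form up to a scalar. A generated map is therefore
`z • M` with `M` of this form, and if its amplitudes lie in `𝔾_p` and are not all zero, a nonzero
one forces `z ∈ 𝔾_p`.
-/

noncomputable section

namespace QupitZX

open Finset

section Scalars

variable {p : ℕ}

theorem omegaPow_zero : omegaPow p 0 = 1 := by simp [omegaPow]

theorem omegaPow_ne_zero (a : ZMod p) : omegaPow p a ≠ 0 :=
  pow_ne_zero _ (Complex.exp_ne_zero _)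

/-- `√p`, as a complex number. -/
def sqrtP (p : ℕ) : ℂ := (Real.sqrt p : ℂ)

/-- The root of unity that generates the phases `ℙ_p` together with `ω`. -/
def phaseUnit (p : ℕ) : ℂ := if p % 4 = 1 then -1 else Complex.I

theorem sqrtP_mul_self : sqrtP p * sqrtP p = p := by
  rw [sqrtP, ← Complex.ofReal_mul, Real.mul_self_sqrt p.cast_nonneg, Complex.ofReal_natCast]

theorem star_sqrtP : star (sqrtP p) = sqrtP p := Complex.conj_ofReal _

theorem phaseUnit_pow_four : phaseUnit p ^ 4 = 1 := by
  unfold phaseUnit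
  split_ifs
  · norm_num
  · exact Complex.I_pow_four

theorem phaseUnit_ne_zero : phaseUnit p ≠ 0 :=
  pow_ne_zero_iff four_ne_zero |>.1 (phaseUnit_pow_four.trans_ne one_ne_zero)

theorem one_mem_phaseGroup : (1 : ℂ) ∈ phaseGroup p := ⟨0, 0, by simp⟩

variable [Fact p.Prime]

theorem omegaPow_add (a b : ZMod p) : omegaPow p (a + b) = omegaPow p a * omegaPow p b := by
  simp only [omegaPow_eq_stdAddChar, AddChar.map_add_eq_mul]

theorem omegaPow_neg (a : ZMod p) : omegaPow p (-a) = (omegaPow p a)⁻¹ := by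
  simp only [omegaPow_eq_stdAddChar, AddChar.map_neg_eq_inv]

theorem omegaPow_sum {ι : Type*} (s : Finset ι) (f : ι → ZMod p) :
    omegaPow p (∑ i ∈ s, f i) = ∏ i ∈ s, omegaPow p (f i) := by
  simp only [omegaPow_eq_stdAddChar]
  exact map_prod (AddChar.toMonoidHom ZMod.stdAddChar) (fun i => Multiplicative.ofAdd (f i)) s

theorem omegaPow_injective : Function.Injective (omegaPow p) := fun a b h =>
  ZMod.injective_stdAddChar (by simpa only [omegaPow_eq_stdAddChar] using h)

theorem star_omegaPow (a : ZMod p) : star (omegaPow p a) = omegaPow p (-a) := by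
  rw [omegaPow_eq_stdAddChar, omegaPow_eq_stdAddChar, AddChar.map_neg_eq_conj]
  rfl

theorem sum_omegaPow_mul (a : ZMod p) :
    ∑ k : ZMod p, omegaPow p (k * a) = if a = 0 then (p : ℂ) else 0 := by
  simpa only [omegaPow_eq_stdAddChar, ZMod.card, Nat.cast_ite, Nat.cast_zero] using
    AddChar.sum_mulShift a (ZMod.isPrimitive_stdAddChar p)

theorem omega_zpow (t : ℤ) : omega p ^ t = omegaPow p t := by
  have : Fact (1 < p) := ⟨(Fact.out : p.Prime).one_lt⟩
  have h : omega p = omegaPow p 1 := by simp [omegaPow, ZMod.val_one]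
  rw [h, omegaPow_eq_stdAddChar, omegaPow_eq_stdAddChar, ← AddChar.map_zsmul_eq_zpow, zsmul_one]

theorem natCast_prime_ne_zero : (p : ℂ) ≠ 0 := Nat.cast_ne_zero.2 (Fact.out : p.Prime).ne_zero

theorem sqrtP_ne_zero : sqrtP p ≠ 0 :=
  left_ne_zero_of_mul (sqrtP_mul_self.trans_ne natCast_prime_ne_zero)

theorem mem_scalarMonoid_iff {z : ℂ} : z ∈ scalarMonoid p ↔
    z = 0 ∨ ∃ (r s : ℤ) (a : ZMod p), z = sqrtP p ^ r * phaseUnit p ^ s * omegaPow p a := by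
  have hsqrt (r : ℤ) : (Real.sqrt ((p : ℝ) ^ r) : ℂ) = sqrtP p ^ r := by
    rw [sqrtP, ← Complex.ofReal_zpow, Real.sqrt_eq_rpow, Real.sqrt_eq_rpow,
      ← Real.rpow_intCast, ← Real.rpow_intCast, ← Real.rpow_mul p.cast_nonneg,
      ← Real.rpow_mul p.cast_nonneg, mul_comm]
  refine or_congr_right ⟨?_, ?_⟩
  · rintro ⟨r, -, ⟨s, t, rfl⟩, rfl⟩
    exact ⟨r, s, t, by rw [hsqrt, omega_zpow, mul_assoc]; rfl⟩
  · rintro ⟨r, s, a, rfl⟩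
    refine ⟨r, _, ⟨s, a.val, rfl⟩, ?_⟩
    rw [hsqrt, omega_zpow, mul_assoc, Int.cast_natCast, ZMod.natCast_zmod_val]
    rfl

variable (p) in
/-- The monoid `𝔾_p`, as a submonoid of `ℂ`. -/
def scalars : Submonoid ℂ where
  carrier := scalarMonoid p
  one_mem' := mem_scalarMonoid_iff.2 (Or.inr ⟨0, 0, 0, by simp [omegaPow_zero]⟩)
  mul_mem' := by
    simp only [mem_scalarMonoid_iff]
    rintro _ _ (rfl | ⟨r, s, a, rfl⟩) (rfl | ⟨r', s', a', rfl⟩)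
    · simp
    · simp
    · simp
    · refine Or.inr ⟨r + r', s + s', a + a', ?_⟩
      rw [zpow_add₀ sqrtP_ne_zero, zpow_add₀ phaseUnit_ne_zero, omegaPow_add]
      ring

theorem mem_scalars_iff {z : ℂ} : z ∈ scalars p ↔
    z = 0 ∨ ∃ (r s : ℤ) (a : ZMod p), z = sqrtP p ^ r * phaseUnit p ^ s * omegaPow p a :=
  mem_scalarMonoid_iff

theorem zero_mem_scalars : (0 : ℂ) ∈ scalars p := Or.inl rfl

theorem sqrtP_mem_scalars : sqrtP p ∈ scalars p :=
  mem_scalars_iff.2 (Or.inr ⟨1, 0, 0, by simp [omegaPow_zero]⟩)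

theorem phaseUnit_mem_scalars : phaseUnit p ∈ scalars p :=
  mem_scalars_iff.2 (Or.inr ⟨0, 1, 0, by simp [omegaPow_zero]⟩)

theorem omegaPow_mem_scalars (a : ZMod p) : omegaPow p a ∈ scalars p :=
  mem_scalars_iff.2 (Or.inr ⟨0, 0, a, by simp⟩)

theorem inv_mem_scalars {z : ℂ} (hz : z ∈ scalars p) : z⁻¹ ∈ scalars p := by
  rw [mem_scalars_iff] at hz ⊢
  rcases hz with rfl | ⟨r, s, a, rfl⟩
  · simp
  · exact Or.inr ⟨-r, -s, -a, by simp only [mul_inv, zpow_neg, omegaPow_neg]⟩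

theorem star_mem_scalars {z : ℂ} (hz : z ∈ scalars p) : star z ∈ scalars p := by
  have hunit : star (phaseUnit p) = (phaseUnit p)⁻¹ := by
    unfold phaseUnit
    split_ifs <;> simp
  rw [mem_scalars_iff] at hz ⊢
  rcases hz with rfl | ⟨r, s, a, rfl⟩
  · simp
  · refine Or.inr ⟨r, -s, -a, ?_⟩
    rw [star_mul', star_mul', star_zpow₀, star_zpow₀, star_sqrtP, hunit, inv_zpow', star_omegaPow]

theorem neg_one_mem_scalars : (-1 : ℂ) ∈ scalars p := by
  by_cases h : p % 4 = 1
  · simpa [phaseUnit, h] using phaseUnit_mem_scalars (p := p)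
  · simpa [phaseUnit, h] using pow_mem (phaseUnit_mem_scalars (p := p)) 2

theorem natCast_prime_mem_scalars : (p : ℂ) ∈ scalars p :=
  sqrtP_mul_self (p := p) ▸ mul_mem sqrtP_mem_scalars sqrtP_mem_scalars

theorem scalars_le {S : Submonoid ℂ} (h_zero : 0 ∈ S) (h_sqrtP : sqrtP p ∈ S)
    (h_inv : (sqrtP p)⁻¹ ∈ S) (h_unit : phaseUnit p ∈ S) (h_omega : ∀ a, omegaPow p a ∈ S) :
    scalars p ≤ S := by
  have hzpow {u : ℂ} (hu : u ∈ S) (hu' : u⁻¹ ∈ S) (r : ℤ) : u ^ r ∈ S := by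
    cases r with
    | ofNat n => simpa using pow_mem hu n
    | negSucc n => simpa [zpow_negSucc] using pow_mem hu' (n + 1)
  have h_unit_inv : (phaseUnit p)⁻¹ ∈ S := by
    rw [inv_eq_of_mul_eq_one_right ((pow_succ' _ 3).symm.trans phaseUnit_pow_four)]
    exact pow_mem h_unit 3
  intro z hz
  rcases mem_scalars_iff.1 hz with rfl | ⟨r, s, a, rfl⟩
  · exact h_zero
  · exact mul_mem (mul_mem (hzpow h_sqrtP h_inv r) (hzpow h_unit h_unit_inv s)) (h_omega a)

end Scalars

section GaussSum

theorem sum_addChar_sq {F R : Type*} [Field F] [Fintype F] [DecidableEq F] [CommRing R]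
    [IsDomain R] (hF : ringChar F ≠ 2) {ψ : AddChar F R} (hψ : ψ ≠ 1) :
    ∑ k, ψ (k ^ 2) = gaussSum ((quadraticChar F).ringHomComp (Int.castRingHom R)) ψ := by
  have hcard (t : F) : ((#{k : F | k ^ 2 = t} : ℕ) : R) = (quadraticChar F t : R) + 1 := by
    have := quadraticChar_card_sqrts hF t
    rw [Set.toFinset_ofPred] at this
    rw [← Int.cast_natCast, this, Int.cast_add, Int.cast_one]
  calc ∑ k, ψ (k ^ 2)
      = ∑ t, ∑ k with k ^ 2 = t, ψ (k ^ 2) := (sum_fiberwise _ _ _).symm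
    _ = ∑ t, ((quadraticChar F t : R) + 1) * ψ t := by
        refine sum_congr rfl fun t _ => ?_
        rw [← hcard, ← nsmul_eq_mul]
        exact sum_eq_card_nsmul fun k hk => by rw [(mem_filter.1 hk).2]
    _ = gaussSum _ ψ := by
        simp only [add_mul, sum_add_distrib, one_mul, AddChar.sum_eq_zero_of_ne_one hψ, add_zero]
        rfl

variable {p : ℕ} [Fact p.Prime]

theorem zmod_two_ne_zero (hp : p ≠ 2) : (2 : ZMod p) ≠ 0 :=
  Ring.two_ne_zero (by rwa [ZMod.ringChar_zmod_n])

theorem sum_omegaPow_mul_sq_eq_or (hp : p ≠ 2) {a : ZMod p} (ha : a ≠ 0) :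
    ∑ k : ZMod p, omegaPow p (a * k ^ 2) = phaseUnit p * sqrtP p ∨
      ∑ k : ZMod p, omegaPow p (a * k ^ 2) = -(phaseUnit p * sqrtP p) := by
  have hF : ringChar (ZMod p) ≠ 2 := by rwa [ZMod.ringChar_zmod_n]
  have hψ : ZMod.stdAddChar.mulShift a ≠ 1 := ZMod.isPrimitive_stdAddChar p ha
  have hχ : (quadraticChar (ZMod p)).ringHomComp (Int.castRingHom ℂ) ≠ 1 :=
    (MulChar.ringHomComp_ne_one_iff Int.cast_injective).2 (quadraticChar_ne_one hF)
  have hsum : ∑ k : ZMod p, omegaPow p (a * k ^ 2) =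
      gaussSum ((quadraticChar (ZMod p)).ringHomComp (Int.castRingHom ℂ))
        (ZMod.stdAddChar.mulShift a) := by
    simpa only [omegaPow_eq_stdAddChar, AddChar.mulShift_apply] using sum_addChar_sq hF hψ
  rw [← sq_eq_sq_iff_eq_or_eq_neg, hsum, gaussSum_sq hχ ((quadraticChar_isQuadratic _).comp _)
    (AddChar.IsPrimitive.of_ne_one hψ), MulChar.ringHomComp_apply, quadraticChar_neg_one hF,
    ZMod.card, mul_pow, sq (sqrtP p), sqrtP_mul_self, phaseUnit]
  have hodd := (Fact.out : p.Prime).eq_two_or_odd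
  split_ifs with h
  · simp [ZMod.χ₄_nat_one_mod_four h]
  · simp [ZMod.χ₄_nat_three_mod_four (show p % 4 = 3 by omega)]

theorem sum_omegaPow_mem_scalars (hp : p ≠ 2) (a b : ZMod p) :
    ∑ k : ZMod p, omegaPow p (a * k ^ 2 + b * k) ∈ scalars p := by
  rcases eq_or_ne a 0 with rfl | ha
  · simp only [zero_mul, zero_add, mul_comm b, sum_omegaPow_mul]
    split_ifs
    exacts [natCast_prime_mem_scalars, zero_mem_scalars]
  have h2 := zmod_two_ne_zero hp
  have complete_square (k : ZMod p) : a * k ^ 2 + b * k =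
      -(b ^ 2 / (2 * 2 * a)) + a * (k + b / (2 * a)) ^ 2 := by
    field_simp
    ring
  have shift : ∑ k, omegaPow p (a * (k + b / (2 * a)) ^ 2) = ∑ k, omegaPow p (a * k ^ 2) :=
    Equiv.sum_comp (Equiv.addRight (b / (2 * a))) fun k => omegaPow p (a * k ^ 2)
  simp only [complete_square, omegaPow_add, ← mul_sum, shift]
  refine mul_mem (omegaPow_mem_scalars _) ?_
  have h := mul_mem (phaseUnit_mem_scalars (p := p)) sqrtP_mem_scalars
  rcases sum_omegaPow_mul_sq_eq_or hp ha with h' | h' <;> rw [h']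
  · exact h
  · exact neg_one_mul (phaseUnit p * sqrtP p) ▸ mul_mem neg_one_mem_scalars h

end GaussSum

section Quadratic

variable {R V W : Type*} [CommRing R] [AddCommGroup V] [Module R V] [AddCommGroup W] [Module R W]

/-- Polynomial functions of degree at most two on a module. -/
def IsQuadratic (q : V → R) : Prop :=
  ∃ (Q : QuadraticForm R V) (l : Module.Dual R V) (c : R), ∀ v, q v = Q v + l v + c

namespace IsQuadratic

theorem const (c : R) : IsQuadratic fun _ : V => c := ⟨0, 0, c, by simp⟩

theorem linear (l : Module.Dual R V) : IsQuadratic fun v => l v := ⟨0, l, 0, by simp⟩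

theorem quadraticForm (Q : QuadraticForm R V) : IsQuadratic fun v => Q v := ⟨Q, 0, 0, by simp⟩

theorem linear_mul (l m : Module.Dual R V) : IsQuadratic fun v => l v * m v :=
  quadraticForm (QuadraticMap.linMulLin l m)

theorem bilinear (B : V →ₗ[R] V →ₗ[R] R) : IsQuadratic fun v => B v v :=
  quadraticForm (LinearMap.BilinMap.toQuadraticMap B)

theorem add {q r : V → R} (hq : IsQuadratic q) (hr : IsQuadratic r) :
    IsQuadratic fun v => q v + r v := by
  obtain ⟨Q, l, c, h⟩ := hq
  obtain ⟨Q', l', c', h'⟩ := hr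
  refine ⟨Q + Q', l + l', c + c', fun v => ?_⟩
  simp only [h, h', _root_.add_apply, LinearMap.add_apply]
  ring

theorem const_mul (a : R) {q : V → R} (hq : IsQuadratic q) : IsQuadratic fun v => a * q v := by
  obtain ⟨Q, l, c, h⟩ := hq
  refine ⟨a • Q, a • l, a * c, fun v => ?_⟩
  simp only [h, _root_.smul_apply, LinearMap.smul_apply, smul_eq_mul]
  ring

theorem comp {q : V → R} (hq : IsQuadratic q) (f : W →ₗ[R] V) : IsQuadratic fun w => q (f w) := by
  obtain ⟨Q, l, c, h⟩ := hq
  exact ⟨Q.comp f, l.comp f, c, fun w => h (f w)⟩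

theorem translate {q : V → R} (hq : IsQuadratic q) (v₀ : V) :
    IsQuadratic fun v => q (v₀ + v) := by
  obtain ⟨Q, l, c, h⟩ := hq
  refine ⟨Q, l + Q.polarBilin v₀, Q v₀ + l v₀ + c, fun v => ?_⟩
  simp only [h, map_add, LinearMap.add_apply, QuadraticMap.polarBilin_apply_apply,
    QuadraticMap.polar]
  ring

theorem exists_diagonal {K V : Type*} [Field K] [Invertible (2 : K)] [AddCommGroup V] [Module K V]
    [FiniteDimensional K V] {q : V → K} (hq : IsQuadratic q) :
    ∃ (e : (Fin (Module.finrank K V) → K) ≃ₗ[K] V) (a b : Fin (Module.finrank K V) → K) (c : K),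
      ∀ x, q (e x) = ∑ i, (a i * x i ^ 2 + b i * x i) + c := by
  obtain ⟨Q, l, c, h⟩ := hq
  obtain ⟨a, ⟨e⟩⟩ := Q.equivalent_weightedSumSquares
  refine ⟨e.toLinearEquiv.symm, a,
    fun i => l (e.toLinearEquiv.symm fun j => if i = j then 1 else 0), c, fun x => ?_⟩
  have hQ : Q (e.toLinearEquiv.symm x) = ∑ i, a i * x i ^ 2 := by
    rw [← e.map_app, ← e.coe_toLinearEquiv, e.toLinearEquiv.apply_symm_apply,
      QuadraticMap.weightedSumSquares_apply]
    simp only [smul_eq_mul, sq]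
  have hl := LinearMap.pi_apply_eq_sum_univ (l.comp e.toLinearEquiv.symm.toLinearMap) x
  simp only [LinearMap.comp_apply, LinearEquiv.coe_coe, smul_eq_mul] at hl
  rw [h, hQ, hl, ← sum_add_distrib]
  simp only [mul_comm]

end IsQuadratic

end Quadratic

section Gaussian

variable {p : ℕ} [Fact p.Prime]

theorem IsQuadratic.sum_omegaPow_mem_scalars {W : Type*} [AddCommGroup W] [Module (ZMod p) W]
    [Fintype W] (hp : p ≠ 2) {q : W → ZMod p} (hq : IsQuadratic q) :
    ∑ w, omegaPow p (q w) ∈ scalars p := by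
  have : Invertible (2 : ZMod p) := invertibleOfNonzero (zmod_two_ne_zero hp)
  obtain ⟨e, a, b, c, h⟩ := hq.exists_diagonal
  have factor := prod_univ_sum (fun _ => (univ : Finset (ZMod p)))
    fun i k => omegaPow p (a i * k ^ 2 + b i * k)
  rw [Fintype.piFinset_univ] at factor
  have hsum : ∑ w, omegaPow p (q w) =
      (∏ i, ∑ k, omegaPow p (a i * k ^ 2 + b i * k)) * omegaPow p c := by
    rw [← e.toEquiv.sum_comp, factor, sum_mul]
    exact sum_congr rfl fun x _ => by rw [LinearEquiv.coe_toEquiv, h, omegaPow_add, omegaPow_sum]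
  rw [hsum]
  exact mul_mem (prod_mem fun i _ => QupitZX.sum_omegaPow_mem_scalars hp _ _)
    (omegaPow_mem_scalars c)

variable {V W : Type*} [AddCommGroup V] [Module (ZMod p) V] [AddCommGroup W] [Module (ZMod p) W]

variable (p) in
/-- Quadratic exponential sums `v ↦ c ∑_w ω^{q(v,w)}`, where `q` has degree at most two and
`c ∈ 𝔾_p`. The sum runs over the basis states `w` of some number of wires. -/
def IsGaussian (f : V → ℂ) : Prop :=
  ∃ (k : ℕ) (c : ℂ) (q : V × Basis p k → ZMod p), c ∈ scalars p ∧ IsQuadratic q ∧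
    ∀ v, f v = c * ∑ w, omegaPow p (q (v, w))

namespace IsGaussian

theorem of_sum [Fintype W] {c : ℂ} (hc : c ∈ scalars p) {q : V × W → ZMod p}
    (hq : IsQuadratic q) : IsGaussian p fun v => c * ∑ w, omegaPow p (q (v, w)) := by
  let e := (Module.finBasis (ZMod p) W).equivFun
  refine ⟨_, c, _, hc, hq.comp (LinearMap.id.prodMap e.symm.toLinearMap), fun v => ?_⟩
  exact congrArg (c * ·) (e.symm.toEquiv.sum_comp fun w => omegaPow p (q (v, w))).symm

theorem mem_scalars (hp : p ≠ 2) {f : V → ℂ} (hf : IsGaussian p f) (v : V) : f v ∈ scalars p := by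
  obtain ⟨k, c, q, hc, hq, h⟩ := hf
  have hqv := (hq.translate (v, 0)).comp (LinearMap.inr (ZMod p) V (Basis p k))
  simp only [LinearMap.inr_apply, Prod.mk_add_mk, add_zero, zero_add] at hqv
  exact h v ▸ mul_mem hc (hqv.sum_omegaPow_mem_scalars hp)

theorem const {c : ℂ} (hc : c ∈ scalars p) : IsGaussian p fun _ : V => c := by
  simpa [omegaPow_zero] using of_sum (V := V) (W := Basis p 0) hc (IsQuadratic.const 0)

theorem omegaPow {q : V → ZMod p} (hq : IsQuadratic q) :
    IsGaussian p fun v => omegaPow p (q v) := by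
  simpa using of_sum (one_mem _) (hq.comp (LinearMap.fst (ZMod p) V (Basis p 0)))

theorem comp {f : V → ℂ} (hf : IsGaussian p f) (g : W →ₗ[ZMod p] V) :
    IsGaussian p fun w => f (g w) := by
  obtain ⟨k, c, q, hc, hq, h⟩ := hf
  exact ⟨k, c, _, hc, hq.comp (g.prodMap LinearMap.id), fun w => h (g w)⟩

theorem translate {f : V → ℂ} (hf : IsGaussian p f) (v₀ : V) :
    IsGaussian p fun v => f (v₀ + v) := by
  obtain ⟨k, c, q, hc, hq, h⟩ := hf
  exact ⟨k, c, _, hc, hq.translate (v₀, 0), fun v => by simp [h]⟩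

protected theorem star {f : V → ℂ} (hf : IsGaussian p f) : IsGaussian p fun v => star (f v) := by
  obtain ⟨k, c, q, hc, hq, h⟩ := hf
  refine ⟨k, star c, _, star_mem_scalars hc, hq.const_mul (-1), fun v => ?_⟩
  simp only [h, star_mul', star_sum, star_omegaPow, neg_one_mul]

theorem mul {f g : V → ℂ} (hf : IsGaussian p f) (hg : IsGaussian p g) :
    IsGaussian p fun v => f v * g v := by
  obtain ⟨k, c, q, hc, hq, h⟩ := hf
  obtain ⟨l, d, r, hd, hr, h'⟩ := hg
  convert of_sum (mul_mem hc hd)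
    ((hq.comp (LinearMap.id.prodMap (LinearMap.fst (ZMod p) (Basis p k) (Basis p l)))).add
      (hr.comp (LinearMap.id.prodMap (LinearMap.snd (ZMod p) (Basis p k) (Basis p l))))) using 2
    with v
  simp only [h, h', omegaPow_add, Fintype.sum_prod_type, LinearMap.prodMap_apply,
    LinearMap.id_apply, LinearMap.fst_apply, LinearMap.snd_apply, ← mul_sum, ← sum_mul]
  ring

theorem sum [Fintype W] {f : V × W → ℂ} (hf : IsGaussian p f) :
    IsGaussian p fun v => ∑ w, f (v, w) := by
  obtain ⟨k, c, q, hc, hq, h⟩ := hf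
  convert of_sum hc
    (hq.comp (LinearEquiv.prodAssoc (ZMod p) V W (Basis p k)).symm.toLinearMap) using 2 with v
  simp only [h, ← mul_sum, Fintype.sum_prod_type]
  rfl

theorem prod {ι : Type*} (s : Finset ι) {f : ι → V → ℂ} (h : ∀ i, IsGaussian p (f i)) :
    IsGaussian p fun v => ∏ i ∈ s, f i v := by
  classical
  induction s using Finset.induction_on with
  | empty => simpa using const (one_mem (scalars p))
  | insert a s ha ih => simpa only [prod_insert ha] using (h a).mul ih

theorem ite_eq (l m : Module.Dual (ZMod p) V) :
    IsGaussian p fun v => if l v = m v then (1 : ℂ) else 0 := by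
  have hsum : IsGaussian p fun v => (p : ℂ)⁻¹ * ∑ k, QupitZX.omegaPow p (k * (l v - m v)) :=
    of_sum (inv_mem_scalars natCast_prime_mem_scalars) (IsQuadratic.linear_mul
      (LinearMap.snd (ZMod p) V (ZMod p)) ((l - m).comp (LinearMap.fst (ZMod p) V (ZMod p))))
  simpa only [sum_omegaPow_mul, sub_eq_zero, mul_ite, mul_zero,
    inv_mul_cancel₀ natCast_prime_ne_zero] using hsum

theorem ite_eq_pi {ι : Type*} [Fintype ι] (g h : V →ₗ[ZMod p] ι → ZMod p) :
    IsGaussian p fun v => if g v = h v then (1 : ℂ) else 0 := by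
  convert prod univ fun i => ite_eq ((LinearMap.proj i).comp g) ((LinearMap.proj i).comp h)
    using 2 with v
  rw [prod_ite_zero]
  simp [funext_iff]

end IsGaussian

end Gaussian

section Operators

variable {p : ℕ}

/-- The operator `∑_y |g(y)⟩⟨y|`. -/
def funOp {m n : ℕ} (g : Basis p m → Basis p n) : Op p m n :=
  Matrix.of fun x y => if x = g y then 1 else 0

/-- The diagonal operator `∑_y ω^{q(y)} |y⟩⟨y|`. -/
def phaseOp {n : ℕ} (q : Basis p n → ZMod p) : Op p n n :=
  Matrix.diagonal fun y => omegaPow p (q y)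

/-- The operator all of whose amplitudes are `1`: the unnormalised uniform superposition of
`n` qupits, composed with its adjoint on `m` qupits. -/
def onesOp (p m n : ℕ) : Op p m n := Matrix.of fun _ _ => 1

theorem phaseOp_zero (n : ℕ) : phaseOp (fun _ : Basis p n => 0) = 1 := by
  simp only [phaseOp, omegaPow_zero, Matrix.diagonal_one]

theorem onesOp_zero_zero : onesOp p 0 0 = 1 := by
  ext x y
  rw [Subsingleton.elim x y, Matrix.one_apply_eq]
  rfl

theorem tensorOp_append {m n m' n' : ℕ} (A : Op p m n) (B : Op p m' n') (x : Basis p n)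
    (x' : Basis p n') (y : Basis p m) (y' : Basis p m') :
    tensorOp A B (Fin.append x x') (Fin.append y y') = A x y * B x' y' := by
  simp only [tensorOp, Matrix.of_apply, Fin.append_left, Fin.append_right]

theorem ext_append {m n m' n' : ℕ} {M N : Op p (m + m') (n + n')}
    (h : ∀ x x' y y', M (Fin.append x x') (Fin.append y y') =
      N (Fin.append x x') (Fin.append y y')) : M = N := by
  ext x y
  rw [← Fin.append_castAdd_natAdd (f := x), ← Fin.append_castAdd_natAdd (f := y)]
  exact h _ _ _ _

theorem append_inj_iff {α : Type*} {m n : ℕ} {x y : Fin m → α} {x' y' : Fin n → α} :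
    Fin.append x x' = Fin.append y y' ↔ x = y ∧ x' = y' :=
  ((Fin.appendEquiv m n).apply_eq_iff_eq (x := (x, x')) (y := (y, y'))).trans Prod.ext_iff

theorem sum_append [NeZero p] {α : Type*} [AddCommMonoid α] {m n : ℕ} (f : Basis p (m + n) → α) :
    ∑ z, f z = ∑ a, ∑ b, f (Fin.append a b) := by
  rw [← (Fin.appendEquiv m n).sum_comp f, Fintype.sum_prod_type]
  rfl

theorem tensorOp_one_one (m n : ℕ) : tensorOp (1 : Op p m m) (1 : Op p n n) = 1 :=
  ext_append fun x x' y y' => by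
    simp only [tensorOp_append, Matrix.one_apply, append_inj_iff, ite_and, mul_ite, mul_one,
      mul_zero]
    split_ifs <;> rfl

theorem tensorOp_onesOp (m n m' n' : ℕ) :
    tensorOp (onesOp p m n) (onesOp p m' n') = onesOp p (m + m') (n + n') :=
  ext_append fun x x' y y' => (tensorOp_append _ _ x x' y y').trans (mul_one 1)

theorem tensorOp_scalarOp {m n : ℕ} (M : Op p m n) (z : ℂ) :
    tensorOp M (scalarOp z : Op p 0 0) = z • M := by
  ext x y
  exact mul_comm _ _

theorem tensorOp_smul_smul {m n m' n' : ℕ} (a b : ℂ) (A : Op p m n) (B : Op p m' n') :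
    tensorOp (a • A) (b • B) = (a * b) • tensorOp A B :=
  ext_append fun x x' y y' => by
    simp only [tensorOp_append, Matrix.smul_apply, smul_eq_mul]
    ring

theorem tensorOp_mul_tensorOp [NeZero p] {k m n k' m' n' : ℕ} (A : Op p m n) (B : Op p m' n')
    (C : Op p k m) (D : Op p k' m') :
    tensorOp A B * tensorOp C D = tensorOp (A * C) (B * D) :=
  ext_append fun x x' y y' => by
    simp only [Matrix.mul_apply, sum_append, tensorOp_append, sum_mul_sum]
    exact sum_congr rfl fun a _ => sum_congr rfl fun b _ => by ring

theorem mul_funOp_apply [NeZero p] {k m n : ℕ} (M : Op p m n) (g : Basis p k → Basis p m)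
    (x : Basis p n) (y : Basis p k) : (M * funOp g) x y = M x (g y) := by
  simp [Matrix.mul_apply, funOp]

variable [Fact p.Prime]

theorem swapOp_eq_funOp : swapOp p = funOp fun y => ![y 1, y 0] := by
  ext x y
  have hket (z : Basis p 2) (k l : ZMod p) : (Pi.single ![k, l] 1 : Basis p 2 → ℂ) z =
      if k = z 0 then if l = z 1 then 1 else 0 else 0 := by
    simp only [Pi.single_apply, ← ite_and, funext_iff, Fin.forall_fin_two, Matrix.cons_val_zero,
      Matrix.cons_val_one, eq_comm]
  have hx : x = ![y 1, y 0] ↔ y 1 = x 0 ∧ y 0 = x 1 := by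
    simp only [funext_iff, Fin.forall_fin_two, Matrix.cons_val_zero, Matrix.cons_val_one, eq_comm]
  simp only [swapOp, Matrix.sum_apply, dyad, Matrix.vecMulVec_apply, Pi.star_apply, hket,
    apply_ite star, star_one, star_zero, funOp, Matrix.of_apply, hx]
  simp [ite_and]

end Operators

section GaussianOperators

variable {p : ℕ} [Fact p.Prime]

/-- The operators whose amplitudes are quadratic exponential sums in the basis labels. -/
def IsGaussianOp {m n : ℕ} (M : Op p m n) : Prop :=
  IsGaussian p fun v : Basis p n × Basis p m => M v.1 v.2

namespace IsGaussianOp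

theorem comp {k m n : ℕ} {A : Op p m n} {B : Op p k m} (hA : IsGaussianOp A)
    (hB : IsGaussianOp B) : IsGaussianOp (A * B) := by
  let x : (Basis p n × Basis p k) × Basis p m →ₗ[ZMod p] Basis p n :=
    LinearMap.fst _ _ _ ∘ₗ LinearMap.fst _ _ _
  let y : (Basis p n × Basis p k) × Basis p m →ₗ[ZMod p] Basis p k :=
    LinearMap.snd _ _ _ ∘ₗ LinearMap.fst _ _ _
  let z : (Basis p n × Basis p k) × Basis p m →ₗ[ZMod p] Basis p m := LinearMap.snd _ _ _
  exact ((IsGaussian.comp hA (x.prod z)).mul (IsGaussian.comp hB (z.prod y))).sum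

theorem tensor {m n m' n' : ℕ} {A : Op p m n} {B : Op p m' n'} (hA : IsGaussianOp A)
    (hB : IsGaussianOp B) : IsGaussianOp (tensorOp A B) :=
  (IsGaussian.comp hA ((LinearMap.funLeft (ZMod p) (ZMod p) (Fin.castAdd n')).prodMap
    (LinearMap.funLeft (ZMod p) (ZMod p) (Fin.castAdd m')))).mul
  (IsGaussian.comp hB ((LinearMap.funLeft (ZMod p) (ZMod p) (Fin.natAdd n)).prodMap
    (LinearMap.funLeft (ZMod p) (ZMod p) (Fin.natAdd m))))

theorem sum_smul_dyad {m n : ℕ} {c : ZMod p → ℂ} {u : ZMod p → Basis p n → ℂ}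
    {v : ZMod p → Basis p m → ℂ} (hc : IsGaussian p c)
    (hu : IsGaussian p fun t : ZMod p × Basis p n => u t.1 t.2)
    (hv : IsGaussian p fun t : ZMod p × Basis p m => v t.1 t.2) :
    IsGaussianOp (∑ k, c k • dyad (u k) (v k)) := by
  let x : (Basis p n × Basis p m) × ZMod p →ₗ[ZMod p] Basis p n :=
    LinearMap.fst _ _ _ ∘ₗ LinearMap.fst _ _ _
  let y : (Basis p n × Basis p m) × ZMod p →ₗ[ZMod p] Basis p m :=
    LinearMap.snd _ _ _ ∘ₗ LinearMap.fst _ _ _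
  let k : (Basis p n × Basis p m) × ZMod p →ₗ[ZMod p] ZMod p := LinearMap.snd _ _ _
  have h := ((hc.comp k).mul ((hu.comp (k.prod x)).mul (hv.star.comp (k.prod y)))).sum
  simp only [IsGaussianOp, Matrix.sum_apply]
  exact h

theorem one (n : ℕ) : IsGaussianOp (1 : Op p n n) := by
  simp only [IsGaussianOp, Matrix.one_apply]
  exact IsGaussian.ite_eq_pi (LinearMap.fst (ZMod p) (Basis p n) (Basis p n))
    (LinearMap.snd (ZMod p) _ _)

theorem swap : IsGaussianOp (swapOp p) := by
  have h := IsGaussian.ite_eq_pi (LinearMap.fst (ZMod p) (Basis p 2) (Basis p 2))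
    (LinearMap.funLeft (ZMod p) (ZMod p) ![1, 0] ∘ₗ LinearMap.snd (ZMod p) _ _)
  have hswap (y : Basis p 2) : LinearMap.funLeft (ZMod p) (ZMod p) ![1, 0] y = ![y 1, y 0] := by
    simp [funext_iff, Fin.forall_fin_two, LinearMap.funLeft_apply]
  simp only [LinearMap.comp_apply, hswap] at h
  rw [swapOp_eq_funOp]
  exact h

end IsGaussianOp

theorem isGaussian_ketPow (n : ℕ) {u : ZMod p → ZMod p → ℂ}
    (hu : IsGaussian p fun t : ZMod p × ZMod p => u t.1 t.2) :
    IsGaussian p fun t : ZMod p × Basis p n => ketPow n (u t.1) t.2 :=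
  IsGaussian.prod univ fun i => hu.comp
    (W := ZMod p × Basis p n) (LinearMap.id.prodMap (LinearMap.proj i))

theorem isGaussian_ketZ : IsGaussian p fun t : ZMod p × ZMod p => ketZ p t.1 t.2 := by
  simp only [ketZ, Pi.single_apply]
  exact IsGaussian.ite_eq (LinearMap.snd (ZMod p) (ZMod p) (ZMod p)) (LinearMap.fst (ZMod p) _ _)

theorem isGaussian_ketX : IsGaussian p fun t : ZMod p × ZMod p => ketX p t.1 t.2 :=
  (IsGaussian.omegaPow (IsQuadratic.linear_mul (LinearMap.fst (ZMod p) (ZMod p) (ZMod p))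
    (LinearMap.snd (ZMod p) (ZMod p) (ZMod p)))).mul
      (IsGaussian.const (inv_mem_scalars sqrtP_mem_scalars))

theorem isQuadratic_spider (a b : ZMod p) :
    IsQuadratic fun k : ZMod p => 2⁻¹ * (a * k + b * k ^ 2) := by
  simp only [sq]
  exact (((IsQuadratic.linear LinearMap.id).const_mul a).add
    ((IsQuadratic.linear_mul LinearMap.id LinearMap.id).const_mul b)).const_mul 2⁻¹

theorem isGaussianOp_greenOp (m n : ℕ) (a b : ZMod p) : IsGaussianOp (greenOp m n a b) :=
  .sum_smul_dyad (.omegaPow (isQuadratic_spider a b)) (isGaussian_ketPow n isGaussian_ketZ)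
    (isGaussian_ketPow m isGaussian_ketZ)

theorem isGaussianOp_redOp (m n : ℕ) (a b : ZMod p) : IsGaussianOp (redOp m n a b) :=
  .sum_smul_dyad (.omegaPow (isQuadratic_spider a b))
    (isGaussian_ketPow n (u := fun k => ketX p (-k)) (isGaussian_ketX.comp
      ((-LinearMap.id).prodMap (LinearMap.id (R := ZMod p) (M := ZMod p)))))
    (isGaussian_ketPow m isGaussian_ketX)

theorem isGaussianOp_interp {m n : ℕ} (D : Diagram p m n) : IsGaussianOp (interp D) := by
  induction D with
  | id n => exact .one n
  | braid => exact .swap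
  | hadamard =>
    simpa only [interp, one_smul] using IsGaussianOp.sum_smul_dyad (.const (one_mem _))
      (isGaussian_ketPow 1 isGaussian_ketX) (isGaussian_ketPow 1 isGaussian_ketZ)
  | star => exact IsGaussian.const neg_one_mem_scalars
  | comp D E hD hE => exact hE.comp hD
  | tensor D E hD hE => exact hD.tensor hE
  | antipode | redUnit | redCounit | redMult | redComult => exact isGaussianOp_redOp _ _ _ _
  | _ => exact isGaussianOp_greenOp _ _ _ _

end GaussianOperators

section Induction

variable {p : ℕ}

theorem tensorOp_onesOp_tensorOp_apply {k m n : ℕ} (x : Basis p n) (y : Basis p m) (w : Basis p k)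
    (y' : Basis p m) : (tensorOp (onesOp p 0 n) (tensorOp (1 : Op p m m) (onesOp p 0 k)))
      (Fin.append x (Fin.append y w)) (fun i => y' (Fin.cast (Nat.zero_add m) i)) =
        if y = y' then 1 else 0 := by
  have hy : (fun i => y' (Fin.cast (Nat.zero_add m) i)) = Fin.append (default : Basis p 0) y' :=
    (Fin.append_left_nil _ y' rfl).symm
  have hy' : y' = Fin.append y' (default : Basis p 0) := (Fin.append_right_nil y' _ rfl).symm
  refine (congrArg _ hy).trans ((tensorOp_append _ _ _ _ _ _).trans ?_)
  conv_lhs => rw [hy']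
  rw [tensorOp_append]
  simp only [onesOp, Matrix.of_apply, one_mul, mul_one, Matrix.one_apply]

variable [Fact p.Prime]

theorem tensorOp_one_onesOp_mul_apply {l m n : ℕ} (M : Op p l (m + n)) (x : Basis p m)
    (y : Basis p l) : (tensorOp (1 : Op p m m) (onesOp p n 0) * M : Op p l (m + 0)) x y =
      ∑ b, M (Fin.append x b) y := by
  have hx : x = Fin.append x (default : Basis p 0) := (Fin.append_right_nil x _ rfl).symm
  rw [Matrix.mul_apply, sum_append]
  conv_lhs => rw [hx]
  simp only [tensorOp_append, Matrix.one_apply, onesOp, Matrix.of_apply, mul_one, ite_mul, one_mul,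
    zero_mul]
  rw [sum_comm]
  simp only [sum_ite_eq, mem_univ, if_true]

theorem IsGaussianOp.exists_eq_smul {m n : ℕ} {M : Op p m n} (hM : IsGaussianOp M) :
    ∃ (k : ℕ) (c : ℂ) (q : Basis p (n + (m + k)) → ZMod p), c ∈ scalars p ∧ IsQuadratic q ∧
      M = c • (tensorOp (1 : Op p n n) (onesOp p (m + k) 0) * phaseOp q *
        (tensorOp (onesOp p 0 n) (tensorOp (1 : Op p m m) (onesOp p 0 k))).submatrix id
          fun y i => y (Fin.cast (Nat.zero_add m) i)) := by
  obtain ⟨k, c, q, hc, hq, h⟩ := hM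
  let x := LinearMap.funLeft (ZMod p) (ZMod p) (Fin.castAdd (m + k) : Fin n → Fin (n + (m + k)))
  let y := LinearMap.funLeft (ZMod p) (ZMod p)
    (Fin.natAdd n ∘ Fin.castAdd k : Fin m → Fin (n + (m + k)))
  let w := LinearMap.funLeft (ZMod p) (ZMod p)
    (Fin.natAdd n ∘ Fin.natAdd m : Fin k → Fin (n + (m + k)))
  refine ⟨k, c, _, hc, hq.comp ((x.prod y).prod w), ?_⟩
  have hxyw (u v t) : ((x.prod y).prod w) (Fin.append u (Fin.append v t)) = ((u, v), t) := by
    simp [x, y, w, LinearMap.funLeft, funext_iff]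
  ext u v
  rw [Matrix.smul_apply, Matrix.mul_assoc, tensorOp_one_onesOp_mul_apply, sum_append, smul_eq_mul]
  refine (h (u, v)).trans (congrArg (c * ·) ?_)
  simp only [phaseOp, Matrix.diagonal_mul, Matrix.submatrix_apply, id_eq, hxyw,
    tensorOp_onesOp_tensorOp_apply, mul_ite, mul_one, mul_zero]
  rw [sum_comm]
  simp only [sum_ite_eq', mem_univ, if_true]

theorem IsGaussianOp.induction {P : ∀ {m n : ℕ}, Op p m n → Prop}
    (comp : ∀ {k m n : ℕ} {A : Op p m n} {B : Op p k m}, P A → P B → P (A * B))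
    (tensor : ∀ {m n m' n' : ℕ} {A : Op p m n} {B : Op p m' n'}, P A → P B → P (tensorOp A B))
    (scalar : ∀ {c : ℂ}, c ∈ scalars p → P (scalarOp c : Op p 0 0))
    (phase : ∀ {n : ℕ} {q : Basis p n → ZMod p}, IsQuadratic q → P (phaseOp q))
    (state : P (onesOp p 0 1)) (effect : P (onesOp p 1 0)) {m n : ℕ} {M : Op p m n}
    (hM : IsGaussianOp M) : P M := by
  have one (n : ℕ) : P (1 : Op p n n) := phaseOp_zero (p := p) n ▸ phase (.const 0)
  have smul {m n : ℕ} {A : Op p m n} {c : ℂ} (hc : c ∈ scalars p) (hA : P A) : P (c • A) :=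
    tensorOp_scalarOp A c ▸ tensor hA (scalar hc)
  have cast {l m n : ℕ} {A : Op p l n} (hA : P A) (h : l = m) :
      P (A.submatrix id fun (y : Basis p m) i => y (Fin.cast h i)) := by
    subst h
    exact hA
  have states (n : ℕ) : P (onesOp p 0 n) := by
    induction n with
    | zero => exact onesOp_zero_zero (p := p) ▸ one 0
    | succ n ih => exact tensorOp_onesOp (p := p) 0 n 0 1 ▸ tensor ih state
  have effects (n : ℕ) : P (onesOp p n 0) := by
    induction n with
    | zero => exact onesOp_zero_zero (p := p) ▸ one 0
    | succ n ih => exact tensorOp_onesOp (p := p) n 0 1 0 ▸ tensor ih effect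
  obtain ⟨k, c, q, hc, hq, rfl⟩ := hM.exists_eq_smul
  exact smul hc (comp (comp (tensor (one n) (effects (m + k))) (phase hq))
    (cast (tensor (states n) (tensor (one m) (states k))) (Nat.zero_add m)))

end Induction

section Clifford

variable {p : ℕ}

theorem tensorOp_conjTranspose {m n m' n' : ℕ} (A : Op p m n) (B : Op p m' n') :
    (tensorOp A B).conjTranspose = tensorOp A.conjTranspose B.conjTranspose := by
  ext x y
  exact star_mul' _ _

variable [Fact p.Prime]

theorem mul_pauli_apply {m n : ℕ} (M : Op p m n) (k : ZMod p) (a b : Basis p m) (x : Basis p n)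
    (y : Basis p m) : (M * pauli k a b) x y = M x (y + a) * omegaPow p (k + b ⬝ᵥ y) := by
  simp [Matrix.mul_apply, pauli]

theorem pauli_mul_apply {m n : ℕ} (M : Op p m n) (k : ZMod p) (a b : Basis p n) (x : Basis p n)
    (y : Basis p m) : (pauli k a b * M) x y = omegaPow p (k + b ⬝ᵥ (x - a)) * M (x - a) y := by
  simp [Matrix.mul_apply, pauli, ← sub_eq_iff_eq_add]

theorem pauli_mul_pauli {n : ℕ} (k l : ZMod p) (a b c d : Basis p n) :
    pauli k a b * pauli l c d = pauli (k + l + b ⬝ᵥ c) (a + c) (b + d) := by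
  ext x y
  simp only [Matrix.mul_apply, pauli, Matrix.of_apply, mul_ite, mul_zero, sum_ite_eq', mem_univ,
    if_true, ite_mul, zero_mul, ← omegaPow_add, dotProduct_add, add_dotProduct, add_assoc y c a,
    add_comm c a]
  ring_nf

theorem smul_pauli {n : ℕ} (k l : ZMod p) (a b : Basis p n) :
    omegaPow p k • pauli l a b = pauli (k + l) a b := by
  ext x y
  simp only [Matrix.smul_apply, smul_eq_mul, pauli, Matrix.of_apply, mul_ite, mul_zero,
    ← omegaPow_add, add_assoc]

theorem pauli_inj {n : ℕ} {k l : ZMod p} {a b c d : Basis p n}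
    (h : pauli k a b = pauli l c d) : k = l ∧ a = c ∧ b = d := by
  have hy (y) : y + a = y + c ∧ k + b ⬝ᵥ y = l + d ⬝ᵥ y := by
    have := congrFun (congrFun h (y + a)) y
    simp only [pauli, Matrix.of_apply, if_true] at this
    split_ifs at this with hac
    · exact ⟨hac, omegaPow_injective this⟩
    · exact absurd this (omegaPow_ne_zero _)
  obtain rfl : k = l := by simpa using (hy 0).2
  exact ⟨rfl, add_left_cancel (hy 0).1, dotProduct_eq _ _ fun y => add_left_cancel (hy y).2⟩

theorem tensorOp_pauli {m n : ℕ} (k l : ZMod p) (a b : Basis p m) (c d : Basis p n) :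
    tensorOp (pauli k a b) (pauli l c d) = pauli (k + l) (Fin.append a c) (Fin.append b d) :=
  ext_append fun x x' y y' => by
    have hadd : Fin.append y y' + Fin.append a c = Fin.append (y + a) (y' + c) := by
      ext i
      refine Fin.addCases (fun i => ?_) (fun i => ?_) i <;> simp
    have hdot : Fin.append b d ⬝ᵥ Fin.append y y' = b ⬝ᵥ y + d ⬝ᵥ y' := by
      simp [dotProduct, Fin.sum_univ_add]
    simp only [tensorOp_append, pauli, Matrix.of_apply, hadd, hdot, append_inj_iff, ite_and,
      ite_mul, mul_ite, zero_mul, mul_zero, ← omegaPow_add, add_add_add_comm k l]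
    split_ifs <;> rfl

theorem isClifford_of_mul_pauli {n : ℕ} {U : Op p n n} (hU : U * U.conjTranspose = 1)
    (h : ∀ k a b, ∃ k' a' b', U * pauli k a b = pauli k' a' b' * U) : IsClifford U := by
  refine ⟨Matrix.mem_unitaryGroup_iff.2 hU, ?_⟩
  rintro _ ⟨k, a, b, rfl⟩
  obtain ⟨k', a', b', h'⟩ := h k a b
  exact ⟨k', a', b', by rw [h', Matrix.mul_assoc, hU, Matrix.mul_one]⟩

theorem isClifford_phaseOp {n : ℕ} {q : Basis p n → ZMod p} (hq : IsQuadratic q) :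
    IsClifford (phaseOp q) := by
  refine isClifford_of_mul_pauli ?_ fun k a b => ?_
  · simp only [phaseOp, Matrix.diagonal_conjTranspose, Matrix.diagonal_mul_diagonal, Pi.star_apply,
      star_omegaPow, ← omegaPow_add, add_neg_cancel, omegaPow_zero, Matrix.diagonal_one]
  obtain ⟨Q, l, c, hq⟩ := hq
  obtain ⟨b', hb'⟩ := (dotProductEquiv (ZMod p) (Fin n)).surjective (Q.polarBilin a)
  have hb'_apply (y) : b' ⬝ᵥ y = Q (a + y) - Q a - Q y := LinearMap.congr_fun hb' y
  refine ⟨k + Q a + l a, a, b' + b, ?_⟩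
  ext x y
  simp only [phaseOp, Matrix.diagonal_mul, Matrix.mul_diagonal, pauli, Matrix.of_apply, mul_ite,
    ite_mul, mul_zero, zero_mul, ← omegaPow_add]
  refine if_ctx_congr Iff.rfl (fun hx => congrArg (omegaPow p) ?_) fun _ => rfl
  rw [hx, hq, hq, add_dotProduct, hb'_apply, map_add l, add_comm a y]
  ring

theorem sum_basis_one {α : Type*} [AddCommMonoid α] (f : Basis p 1 → α) :
    ∑ z, f z = ∑ k, f fun _ => k :=
  ((Equiv.funUnique (Fin 1) (ZMod p)).symm.sum_comp f).symm

variable (p) in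
/-- The Hadamard gate `∑_k |k:X⟩⟨k:Z|`, given by its amplitudes. -/
def hadamardOp : Op p 1 1 := Matrix.of fun x y => omegaPow p (x 0 * y 0) / sqrtP p

theorem isClifford_hadamardOp : IsClifford (hadamardOp p) := by
  refine isClifford_of_mul_pauli ?_ fun k a b => ⟨k - a 0 * b 0, -b, a, ?_⟩
  · ext x y
    have hterm (k : ZMod p) : omegaPow p (x 0 * k) / sqrtP p * star (omegaPow p (y 0 * k) / sqrtP p)
        = (p : ℂ)⁻¹ * omegaPow p (k * (x 0 - y 0)) := by
      rw [star_div₀, star_sqrtP, star_omegaPow, div_mul_div_comm, sqrtP_mul_self, ← omegaPow_add,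
        div_eq_inv_mul]
      ring_nf
    simp only [Matrix.mul_apply, sum_basis_one, Matrix.conjTranspose_apply, hadamardOp,
      Matrix.of_apply, hterm, ← mul_sum, sum_omegaPow_mul, Matrix.one_apply, mul_ite, mul_zero,
      inv_mul_cancel₀ natCast_prime_ne_zero, sub_eq_zero, funext_iff, Fin.forall_fin_one]
  · ext x y
    simp only [mul_pauli_apply, pauli_mul_apply, hadamardOp, Matrix.of_apply, div_mul_eq_mul_div,
      ← mul_div_assoc, ← omegaPow_add, dotProduct, Fin.sum_univ_one, Pi.add_apply, Pi.sub_apply,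
      Pi.neg_apply]
    ring_nf

theorem IsClifford.conjTranspose {n : ℕ} {U : Op p n n} (hU : IsClifford U) :
    IsClifford U.conjTranspose := by
  have hUU : U.conjTranspose * U = 1 := Matrix.mem_unitaryGroup_iff'.1 hU.1
  have hcancel (P : Op p n n) : U.conjTranspose * (U * P * U.conjTranspose) * U = P := by
    rw [Matrix.mul_assoc, Matrix.mul_assoc (U * P), hUU, Matrix.mul_one, ← Matrix.mul_assoc, hUU,
      Matrix.one_mul]
  have : Finite (pauliGroup p n) := Set.Finite.to_subtype <|
    (Set.finite_range fun s : ZMod p × Basis p n × Basis p n => pauli s.1 s.2.1 s.2.2).subset <| by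
      rintro _ ⟨k, a, b, rfl⟩
      exact ⟨(k, a, b), rfl⟩
  let conj (P : pauliGroup p n) : pauliGroup p n := ⟨U * P * U.conjTranspose, hU.2 P P.2⟩
  have hinj : Function.Injective conj := fun P Q h => Subtype.ext <|
    (hcancel P).symm.trans <|
      (congrArg (U.conjTranspose * · * U) (Subtype.ext_iff.1 h)).trans (hcancel Q)
  refine ⟨Unitary.star_mem hU.1, fun P hP => ?_⟩
  obtain ⟨Q, hQ⟩ := Finite.surjective_of_injective hinj ⟨P, hP⟩
  have hQ' : U * Q * U.conjTranspose = P := congrArg Subtype.val hQ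
  rw [Matrix.conjTranspose_conjTranspose, ← hQ', hcancel]
  exact Q.2

theorem IsClifford.tensor {m n : ℕ} {U : Op p m m} {V : Op p n n} (hU : IsClifford U)
    (hV : IsClifford V) : IsClifford (tensorOp U V) := by
  refine ⟨?_, ?_⟩
  · have hUU : U * U.conjTranspose = 1 := Matrix.mem_unitaryGroup_iff.1 hU.1
    have hVV : V * V.conjTranspose = 1 := Matrix.mem_unitaryGroup_iff.1 hV.1
    rw [Matrix.mem_unitaryGroup_iff, Matrix.star_eq_conjTranspose, tensorOp_conjTranspose,
      tensorOp_mul_tensorOp, hUU, hVV, tensorOp_one_one]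
  · rintro _ ⟨k, a, b, rfl⟩
    obtain ⟨⟨a₁, a₂⟩, rfl⟩ := (Fin.appendEquiv m n).surjective a
    obtain ⟨⟨b₁, b₂⟩, rfl⟩ := (Fin.appendEquiv m n).surjective b
    obtain ⟨k₁, c₁, d₁, h₁⟩ := hU.2 _ ⟨k, a₁, b₁, rfl⟩
    obtain ⟨k₂, c₂, d₂, h₂⟩ := hV.2 _ ⟨0, a₂, b₂, rfl⟩
    refine ⟨k₁ + k₂, Fin.append c₁ c₂, Fin.append d₁ d₂, ?_⟩
    rw [← tensorOp_pauli, ← h₁, ← h₂, ← tensorOp_mul_tensorOp, ← tensorOp_mul_tensorOp,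
      tensorOp_pauli, add_zero, tensorOp_conjTranspose]
    rfl

theorem det_tensorOp {m n : ℕ} (U : Op p m m) (V : Op p n n) :
    (tensorOp U V).det = U.det ^ Fintype.card (Basis p n) * V.det ^ Fintype.card (Basis p m) := by
  rw [← Matrix.det_kronecker, ← Matrix.det_submatrix_equiv_self (Fin.appendEquiv m n).symm]
  rfl

theorem IsClifford.tensorOp_conjTranspose_mem_reducedClifford {n : ℕ} {U : Op p n n}
    (hU : IsClifford U) : tensorOp U U.conjTranspose ∈ reducedClifford p (n + n) := by
  refine ⟨1, one_mem_phaseGroup, _, hU.tensor hU.conjTranspose, ?_, (one_smul _ _).symm⟩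
  have hUU : U * U.conjTranspose = 1 := Matrix.mem_unitaryGroup_iff.1 hU.1
  rw [det_tensorOp, ← mul_pow, ← Matrix.det_mul, hUU, Matrix.det_one, one_pow]

end Clifford

section Generated

variable {p : ℕ}

theorem tensorOp_single {m n m' n' : ℕ} (x : Basis p n) (y : Basis p m) (x' : Basis p n')
    (y' : Basis p m') (a b : ℂ) : tensorOp (Matrix.single x y a) (Matrix.single x' y' b) =
      Matrix.single (Fin.append x x') (Fin.append y y') (a * b) :=
  ext_append fun u u' v v' => by
    simp only [tensorOp_append, Matrix.single_apply, append_inj_iff, ← ite_and, ite_mul, mul_ite,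
      zero_mul, mul_zero]
    exact if_congr (by tauto) rfl rfl

theorem append_zero_zero (m n : ℕ) : Fin.append (0 : Basis p m) (0 : Basis p n) = 0 := by
  ext i
  refine Fin.addCases (fun i => ?_) (fun i => ?_) i <;> simp

theorem tensorOp_single_zero_zero (m n m' n' : ℕ) :
    tensorOp (Matrix.single 0 0 1 : Op p m n) (Matrix.single 0 0 1 : Op p m' n') =
      Matrix.single 0 0 1 := by
  rw [tensorOp_single, append_zero_zero, append_zero_zero, mul_one]

theorem single_zero_zero_eq_one : (Matrix.single 0 0 1 : Op p 0 0) = 1 := by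
  ext x y
  rw [Subsingleton.elim x 0, Subsingleton.elim y 0, Matrix.single_apply_same, Matrix.one_apply_eq]

theorem ketPow_ketZ (n : ℕ) (k : ZMod p) : ketPow n (ketZ p k) = Pi.single (fun _ => k) 1 := by
  ext x
  simp only [ketPow, ketZ, Pi.single_apply, prod_ite_zero, prod_const_one, funext_iff, mem_univ,
    true_implies]

theorem dyad_ketPow_ketZ (m n : ℕ) (k l : ZMod p) : (dyad (ketPow n (ketZ p k))
    (ketPow m (ketZ p l)) : Op p m n) = Matrix.single (fun _ => k) (fun _ => l) 1 := by
  rw [dyad, ketPow_ketZ, ketPow_ketZ, Matrix.single_eq_single_vecMulVec_single, Pi.star_single,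
    star_one]

variable [Fact p.Prime]

theorem generated_zero_state (n : ℕ) : Generated (Matrix.single 0 0 1 : Op p 0 n) := by
  induction n with
  | zero => exact single_zero_zero_eq_one (p := p) ▸ Generated.id 0
  | succ n ih =>
    have hstate := dyad_ketPow_ketZ (p := p) 0 1 0 0 ▸ Generated.state
    exact tensorOp_single_zero_zero (p := p) 0 n 0 1 ▸ Generated.tensor _ _ ih hstate

theorem generated_zero_effect (n : ℕ) : Generated (Matrix.single 0 0 1 : Op p n 0) := by
  induction n with
  | zero => exact single_zero_zero_eq_one (p := p) ▸ Generated.id 0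
  | succ n ih =>
    have heffect := dyad_ketPow_ketZ (p := p) 1 0 0 0 ▸ Generated.effect
    exact tensorOp_single_zero_zero (p := p) n 0 1 0 ▸ Generated.tensor _ _ ih heffect

theorem Generated.smul {m n : ℕ} {M : Op p m n} (hM : Generated M) {z : ℂ} (hz : z ∈ scalars p) :
    Generated (z • M) :=
  tensorOp_scalarOp M z ▸ Generated.tensor _ _ hM (Generated.scalar z hz)

theorem generated_of_isClifford {n : ℕ} {U : Op p n n} (hU : IsClifford U) (h_ne : U 0 0 ≠ 0)
    (h_mem : U 0 0 ∈ scalars p) : Generated U := by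
  have hproj : tensorOp (1 : Op p n n) (Matrix.single 0 0 1 : Op p n 0) *
      tensorOp U U.conjTranspose * tensorOp (1 : Op p n n) (Matrix.single 0 0 1 : Op p 0 n) =
        star (U 0 0) • U := by
    rw [tensorOp_mul_tensorOp, tensorOp_mul_tensorOp, Matrix.one_mul, Matrix.mul_one,
      Matrix.single_mul_mul_single, one_mul, mul_one, ← tensorOp_scalarOp]
    congr 1
  have hgen := Generated.comp _ _ (.tensor _ _ (.id n) (generated_zero_state n)) <|
    .comp _ _ (.clifford _ hU.tensorOp_conjTranspose_mem_reducedClifford)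
      (.tensor _ _ (.id n) (generated_zero_effect n))
  rw [hproj] at hgen
  have h := hgen.smul (inv_mem_scalars (star_mem_scalars h_mem))
  rwa [smul_smul, inv_mul_cancel₀ (star_ne_zero.2 h_ne), one_smul] at h

theorem generated_phaseOp {n : ℕ} {q : Basis p n → ZMod p} (hq : IsQuadratic q) :
    Generated (phaseOp q) := by
  have h00 : phaseOp q 0 0 = omegaPow p (q 0) := Matrix.diagonal_apply_eq _ _
  exact generated_of_isClifford (isClifford_phaseOp hq) (h00 ▸ omegaPow_ne_zero _)
    (h00 ▸ omegaPow_mem_scalars _)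

theorem hadamardOp_apply_zero_right (x : Basis p 1) : hadamardOp p x 0 = (sqrtP p)⁻¹ := by
  simp [hadamardOp, omegaPow_zero]

theorem hadamardOp_apply_zero_left (y : Basis p 1) : hadamardOp p 0 y = (sqrtP p)⁻¹ := by
  simp [hadamardOp, omegaPow_zero]

theorem generated_hadamardOp : Generated (hadamardOp p) := by
  have h00 := hadamardOp_apply_zero_right (0 : Basis p 1)
  exact generated_of_isClifford isClifford_hadamardOp (h00 ▸ inv_ne_zero sqrtP_ne_zero)
    (h00 ▸ inv_mem_scalars sqrtP_mem_scalars)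

theorem generated_onesOp_state : Generated (onesOp p 0 1) := by
  have h : onesOp p 0 1 = sqrtP p • (hadamardOp p * (Matrix.single 0 0 1 : Op p 0 1)) := by
    ext x y
    rw [Subsingleton.elim y 0, Matrix.smul_apply, Matrix.mul_single_apply_same,
      hadamardOp_apply_zero_right, mul_one, smul_eq_mul, mul_inv_cancel₀ sqrtP_ne_zero]
    rfl
  exact h ▸ (Generated.comp _ _ (generated_zero_state 1) generated_hadamardOp).smul
    sqrtP_mem_scalars

theorem generated_onesOp_effect : Generated (onesOp p 1 0) := by
  have h : onesOp p 1 0 = sqrtP p • ((Matrix.single 0 0 1 : Op p 1 0) * hadamardOp p) := by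
    ext x y
    rw [Subsingleton.elim x 0, Matrix.smul_apply, Matrix.single_mul_apply_same,
      hadamardOp_apply_zero_left, one_mul, smul_eq_mul, mul_inv_cancel₀ sqrtP_ne_zero]
    rfl
  exact h ▸ (Generated.comp _ _ generated_hadamardOp (generated_zero_effect 1)).smul
    sqrtP_mem_scalars

theorem IsGaussianOp.generated {m n : ℕ} {M : Op p m n} (hM : IsGaussianOp M) : Generated M :=
  hM.induction (fun hA hB => .comp _ _ hB hA) (fun hA hB => .tensor _ _ hA hB)
    (fun hc => .scalar _ hc) generated_phaseOp generated_onesOp_state generated_onesOp_effect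

end Generated

section CliffordAmplitudes

theorem IsQuadratic.of_map_add {N : ℕ} [Invertible (2 : ZMod N)] {V : Type*} [AddCommGroup V]
    [Module (ZMod N) V] {k : V → ZMod N} (β : V →ₗ[ZMod N] V →ₗ[ZMod N] ZMod N)
    (h : ∀ s t, k (s + t) = k s + k t + β s t) : IsQuadratic k := by
  have hsymm (s t) : β s t = β t s := by
    linear_combination h t s - h s t + congrArg k (add_comm s t)
  let l : V →+ ZMod N := AddMonoidHom.mk' (fun s => k s - ⅟2 * β s s) fun s t => by
    simp only [h, map_add, LinearMap.add_apply, hsymm t s]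
    linear_combination (-β s t) * invOf_mul_self (2 : ZMod N)
  have hk := (IsQuadratic.linear (l.toZModLinearMap N)).add
    ((IsQuadratic.bilinear β).const_mul ⅟2)
  convert hk using 2 with s
  exact (sub_add_cancel _ _).symm

variable {p : ℕ} [Fact p.Prime]

theorem IsClifford.exists_conj_pauli_eq (hp : p ≠ 2) {n : ℕ} {U : Op p n n} (hU : IsClifford U) :
    ∃ (k : Basis p n × Basis p n → ZMod p) (A B : Basis p n × Basis p n →ₗ[ZMod p] Basis p n),
      IsQuadratic k ∧
        ∀ s, U * pauli 0 s.1 s.2 * U.conjTranspose = pauli (k s) (A s) (B s) := by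
  choose k A B h using fun s : Basis p n × Basis p n => hU.2 _ ⟨0, s.1, s.2, rfl⟩
  have hUU : U.conjTranspose * U = 1 := Matrix.mem_unitaryGroup_iff'.1 hU.1
  have hadd (s t) : k s + k t + B s ⬝ᵥ A t = s.2 ⬝ᵥ t.1 + k (s + t) ∧ A s + A t = A (s + t) ∧
      B s + B t = B (s + t) := by
    refine pauli_inj ?_
    rw [← pauli_mul_pauli, ← smul_pauli, ← h, ← h, ← h]
    calc U * pauli 0 s.1 s.2 * U.conjTranspose * (U * pauli 0 t.1 t.2 * U.conjTranspose)
        = U * (pauli 0 s.1 s.2 * ((U.conjTranspose * U) * pauli 0 t.1 t.2)) *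
            U.conjTranspose := by simp only [Matrix.mul_assoc]
      _ = U * (omegaPow p (s.2 ⬝ᵥ t.1) • pauli 0 (s + t).1 (s + t).2) * U.conjTranspose := by
          rw [hUU, Matrix.one_mul, pauli_mul_pauli, smul_pauli, add_zero, zero_add, add_zero]
          rfl
      _ = _ := by rw [Matrix.mul_smul, Matrix.smul_mul]
  let A' := (AddMonoidHom.mk' A fun s t => (hadd s t).2.1.symm).toZModLinearMap p
  let B' := (AddMonoidHom.mk' B fun s t => (hadd s t).2.2.symm).toZModLinearMap p
  let dot := (dotProductEquiv (ZMod p) (Fin n)).toLinearMap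
  have : Invertible (2 : ZMod p) := invertibleOfNonzero (zmod_two_ne_zero hp)
  refine ⟨k, A', B', .of_map_add (dot.compl₁₂ B' A' -
    dot.compl₁₂ (LinearMap.snd _ _ _) (LinearMap.fst _ _ _)) fun s t => ?_, h⟩
  change k (s + t) = k s + k t + (B s ⬝ᵥ A t - s.2 ⬝ᵥ t.1)
  linear_combination -(hadd s t).1

theorem sum_omegaPow_dotProduct {n : ℕ} (v : Basis p n) :
    ∑ b : Basis p n, omegaPow p (b ⬝ᵥ v) = if v = 0 then (p : ℂ) ^ n else 0 := by
  simp only [dotProduct, omegaPow_sum, ← Fintype.prod_sum fun i k => omegaPow p (k * v i),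
    sum_omegaPow_mul, prod_ite_zero, prod_const, card_univ, Fintype.card_fin, mem_univ,
    true_implies, funext_iff, Pi.zero_apply]

theorem sum_pauli {n : ℕ} (a : Basis p n) :
    ∑ b, pauli 0 a b = (p : ℂ) ^ n • Matrix.single a 0 1 := by
  ext x y
  simp only [Matrix.sum_apply, pauli, Matrix.of_apply, zero_add, sum_ite_irrel, sum_const_zero,
    sum_omegaPow_dotProduct, Matrix.smul_apply, Matrix.single_apply, smul_eq_mul, mul_ite, mul_one,
    mul_zero, ← ite_and]
  refine if_congr ⟨?_, ?_⟩ rfl rfl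
  · rintro ⟨rfl, rfl⟩
    exact ⟨(zero_add a).symm, rfl⟩
  · rintro ⟨rfl, rfl⟩
    exact ⟨(zero_add a).symm, rfl⟩

theorem isGaussian_pauli {V : Type*} [AddCommGroup V] [Module (ZMod p) V] {n : ℕ} {k : V → ZMod p}
    (hk : IsQuadratic k) (a b x y : V →ₗ[ZMod p] Basis p n) :
    IsGaussian p fun v => pauli (k v) (a v) (b v) (x v) (y v) := by
  have hby := IsQuadratic.bilinear
    ((dotProductEquiv (ZMod p) (Fin n)).toLinearMap.compl₁₂ b y)
  convert (IsGaussian.ite_eq_pi x (y + a)).mul (.omegaPow (hk.add hby)) using 2 with v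
  simp only [pauli, Matrix.of_apply, ite_mul, one_mul, zero_mul]
  rfl

/-- Summing the conjugates of `pauli 0 y b` over `b` isolates the rank-one operator
`U |y⟩⟨0| U†`, whose amplitudes are these products. -/
theorem IsClifford.isGaussian_mul_star (hp : p ≠ 2) {n : ℕ} {U : Op p n n} (hU : IsClifford U) :
    IsGaussian p fun v : (Basis p n × Basis p n) × Basis p n => U v.1.1 v.1.2 * star (U v.2 0) := by
  obtain ⟨k, A, B, hk, h⟩ := hU.exists_conj_pauli_eq hp
  have hentry (x y z : Basis p n) : U x y * star (U z 0) =
      ((p : ℂ) ^ n)⁻¹ * ∑ b, pauli (k (y, b)) (A (y, b)) (B (y, b)) x z := by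
    have hsum : ∑ b, U * pauli 0 y b * U.conjTranspose =
        (p : ℂ) ^ n • (U * Matrix.single y 0 1 * U.conjTranspose) := by
      rw [← Matrix.sum_mul, ← Matrix.mul_sum, sum_pauli, Matrix.mul_smul, Matrix.smul_mul]
    have hxz := congrFun (congrFun hsum x) z
    simp only [Matrix.sum_apply, fun b => h (y, b), Matrix.smul_apply, smul_eq_mul] at hxz
    rw [hxz, inv_mul_cancel_left₀ (pow_ne_zero n natCast_prime_ne_zero), Matrix.mul_assoc]
    simp [Matrix.mul_apply, Matrix.single_apply, ite_and]
  let W := ((Basis p n × Basis p n) × Basis p n) × Basis p n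
  let x : W →ₗ[ZMod p] Basis p n :=
    LinearMap.fst _ _ _ ∘ₗ LinearMap.fst _ _ _ ∘ₗ LinearMap.fst _ _ _
  let z : W →ₗ[ZMod p] Basis p n := LinearMap.snd _ _ _ ∘ₗ LinearMap.fst _ _ _
  let yb : W →ₗ[ZMod p] Basis p n × Basis p n :=
    (LinearMap.snd _ _ _ ∘ₗ LinearMap.fst _ _ _ ∘ₗ LinearMap.fst _ _ _).prod (LinearMap.snd _ _ _)
  simp only [hentry]
  exact (IsGaussian.const (inv_mem_scalars (pow_mem natCast_prime_mem_scalars n))).mul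
    (isGaussian_pauli (hk.comp yb) (A ∘ₗ yb) (B ∘ₗ yb) x z).sum

theorem IsClifford.exists_eq_smul (hp : p ≠ 2) {n : ℕ} {U : Op p n n} (hU : IsClifford U) :
    ∃ (c : ℂ) (G : Op p n n), IsGaussianOp G ∧ U = c • G := by
  have hUU : U.conjTranspose * U = 1 := Matrix.mem_unitaryGroup_iff'.1 hU.1
  obtain ⟨z, hz⟩ : ∃ z, U z 0 ≠ 0 := by
    by_contra! h0
    have := congrFun (congrFun hUU 0) 0
    simp [Matrix.mul_apply, h0] at this
  refine ⟨(star (U z 0))⁻¹, star (U z 0) • U, ?_, by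
    rw [smul_smul, inv_mul_cancel₀ (star_ne_zero.2 hz), one_smul]⟩
  have hG := ((hU.isGaussian_mul_star hp).translate (0, z)).comp (LinearMap.inl (ZMod p) _ _)
  simp only [LinearMap.inl_apply, Prod.mk_add_mk, zero_add, add_zero, mul_comm _ (star _)] at hG
  exact hG

theorem IsGaussianOp.single_zero_zero (m n : ℕ) :
    IsGaussianOp (Matrix.single 0 0 1 : Op p m n) := by
  have h : IsGaussian p fun v : Basis p n × Basis p m =>
      (if 0 = v.1 then (1 : ℂ) else 0) * if 0 = v.2 then 1 else 0 :=
    (IsGaussian.ite_eq_pi 0 (LinearMap.fst (ZMod p) (Basis p n) (Basis p m))).mul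
      (IsGaussian.ite_eq_pi 0 (LinearMap.snd (ZMod p) (Basis p n) (Basis p m)))
  simpa only [IsGaussianOp, Matrix.single_apply, ite_and, ite_mul, one_mul, zero_mul] using h

theorem Generated.exists_eq_smul (hp : p ≠ 2) {m n : ℕ} {M : Op p m n} (hM : Generated M) :
    ∃ (c : ℂ) (G : Op p m n), IsGaussianOp G ∧ M = c • G := by
  have hdyad (m n : ℕ) : IsGaussianOp (dyad (ketPow n (ketZ p 0)) (ketPow m (ketZ p 0))) := by
    rw [dyad_ketPow_ketZ]
    exact .single_zero_zero m n
  induction hM with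
  | id n => exact ⟨1, 1, .one n, (one_smul _ _).symm⟩
  | swap => exact ⟨1, _, .swap, (one_smul _ _).symm⟩
  | state => exact ⟨1, _, hdyad 0 1, (one_smul _ _).symm⟩
  | effect => exact ⟨1, _, hdyad 1 0, (one_smul _ _).symm⟩
  | clifford U hU =>
    obtain ⟨l, -, V, hV, -, rfl⟩ := hU
    obtain ⟨c, G, hG, rfl⟩ := hV.exists_eq_smul hp
    exact ⟨l * c, G, hG, smul_smul l c G⟩
  | scalar z hz => exact ⟨1, scalarOp z, IsGaussian.const hz, (one_smul _ _).symm⟩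
  | comp A B _ _ ihA ihB =>
    obtain ⟨a, G, hG, rfl⟩ := ihA
    obtain ⟨b, G', hG', rfl⟩ := ihB
    exact ⟨b * a, G' * G, hG'.comp hG, by rw [Matrix.smul_mul, Matrix.mul_smul, smul_smul]⟩
  | tensor A B _ _ ihA ihB =>
    obtain ⟨a, G, hG, rfl⟩ := ihA
    obtain ⟨b, G', hG', rfl⟩ := ihB
    exact ⟨a * b, tensorOp G G', hG.tensor hG', tensorOp_smul_smul a b G G'⟩

theorem isStabiliserOperation_iff_isGaussianOp (hp : p ≠ 2) {m n : ℕ} {C : Op p m n} :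
    IsStabiliserOperation C ↔ IsGaussianOp C := by
  refine ⟨fun hC => ?_, fun hC => ⟨hC.generated, fun x y => IsGaussian.mem_scalars hp hC (x, y)⟩⟩
  obtain ⟨c, G, hG, rfl⟩ := hC.1.exists_eq_smul hp
  by_cases h0 : ∀ x y, G x y = 0
  · have hzero : c • G = 0 := by
      ext x y
      simp [h0]
    exact hzero ▸ IsGaussian.const zero_mem_scalars
  · push Not at h0
    obtain ⟨x, y, hxy⟩ := h0
    have hc : c ∈ scalars p := by
      rw [← mul_inv_cancel_right₀ hxy c]
      exact mul_mem (hC.2 x y) (inv_mem_scalars (IsGaussian.mem_scalars hp hG (x, y)))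
    exact (IsGaussian.const hc).mul hG

end CliffordAmplitudes

section Spiders

variable {p : ℕ}

theorem const_eq_iff {k : ZMod p} {y : Basis p 1} : (fun _ => k) = y ↔ k = y 0 := by
  rw [funext_iff, Fin.forall_fin_one]

variable [Fact p.Prime]

theorem spiderPhase_zero_zero (k : ZMod p) : spiderPhase 0 0 k = 1 := by
  rw [spiderPhase, zero_mul, zero_mul, add_zero, mul_zero, omegaPow_zero]

theorem greenOp_apply (m n : ℕ) (a b : ZMod p) (x : Basis p n) (y : Basis p m) :
    greenOp m n a b x y =
      ∑ k, if (fun _ => k) = x ∧ (fun _ => k) = y then spiderPhase a b k else 0 := by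
  simp only [greenOp, dyad_ketPow_ketZ, Matrix.sum_apply, Matrix.smul_apply, Matrix.single_apply,
    smul_eq_mul, mul_ite, mul_one, mul_zero]

theorem greenOp_one_left_apply (n : ℕ) (a b : ZMod p) (x : Basis p n) (y : Basis p 1) :
    greenOp 1 n a b x y = if (fun _ => y 0) = x then spiderPhase a b (y 0) else 0 := by
  simp only [greenOp_apply, const_eq_iff (y := y), and_comm, ite_and, sum_ite_eq', mem_univ,
    if_true]

theorem greenOp_one_right_apply (m : ℕ) (a b : ZMod p) (x : Basis p 1) (y : Basis p m) :
    greenOp m 1 a b x y = if (fun _ => x 0) = y then spiderPhase a b (x 0) else 0 := by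
  simp only [greenOp_apply, const_eq_iff (y := x), ite_and, sum_ite_eq', mem_univ, if_true]

theorem greenOp_one_left_eq_funOp (n : ℕ) :
    greenOp 1 n 0 0 = (funOp fun y _ => y 0 : Op p 1 n) := by
  ext x y
  simp only [greenOp_one_left_apply, spiderPhase_zero_zero, funOp, Matrix.of_apply, eq_comm]

theorem redOp_zero_right_apply (m n : ℕ) (a : ZMod p) (x : Basis p n) (y : Basis p m) :
    redOp m n a 0 x y =
      if 2⁻¹ * a - ∑ i, x i - ∑ i, y i = 0 then p / sqrtP p ^ (n + m) else 0 := by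
  have hket (l : ℕ) (k : ZMod p) (z : Basis p l) :
      ketPow l (ketX p k) z = omegaPow p (k * ∑ i, z i) / sqrtP p ^ l := by
    simp only [ketPow, ketX, prod_div_distrib, mul_sum, omegaPow_sum, prod_const, card_univ,
      Fintype.card_fin, sqrtP]
  have hterm (k : ZMod p) : spiderPhase a 0 k * (ketPow n (ketX p (-k)) x *
      star (ketPow m (ketX p k) y)) =
        omegaPow p (k * (2⁻¹ * a - ∑ i, x i - ∑ i, y i)) / sqrtP p ^ (n + m) := by
    rw [hket, hket, star_div₀, star_pow, star_sqrtP, star_omegaPow, spiderPhase, div_mul_div_comm,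
      ← mul_div_assoc, ← omegaPow_add, ← omegaPow_add, pow_add]
    congr 2
    ring
  simp only [redOp, dyad, Matrix.sum_apply, Matrix.smul_apply, Matrix.vecMulVec_apply,
    Pi.star_apply, smul_eq_mul, hterm, ← sum_div, sum_omegaPow_mul, ite_div, zero_div]

theorem interp_hadamard : interp (.hadamard : Diagram p 1 1) = hadamardOp p := by
  ext x y
  simp [interp, Matrix.sum_apply, dyad, Matrix.vecMulVec_apply, ketPow, ketZ, ketX, hadamardOp,
    sqrtP, Pi.single_apply, apply_ite, mul_comm (y 0)]

end Spiders

section Diagrammatic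

variable {p : ℕ} [Fact p.Prime]

/-- The operators that are the interpretation of some diagram. -/
def IsDiagrammatic {m n : ℕ} (M : Op p m n) : Prop := ∃ D : Diagram p m n, interp D = M

theorem IsDiagrammatic.comp {k m n : ℕ} {A : Op p m n} {B : Op p k m} (hA : IsDiagrammatic A)
    (hB : IsDiagrammatic B) : IsDiagrammatic (A * B) := by
  obtain ⟨D, rfl⟩ := hA
  obtain ⟨E, rfl⟩ := hB
  exact ⟨.comp E D, rfl⟩

theorem IsDiagrammatic.tensor {m n m' n' : ℕ} {A : Op p m n} {B : Op p m' n'}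
    (hA : IsDiagrammatic A) (hB : IsDiagrammatic B) : IsDiagrammatic (tensorOp A B) := by
  obtain ⟨D, rfl⟩ := hA
  obtain ⟨E, rfl⟩ := hB
  exact ⟨.tensor D E, rfl⟩

theorem IsDiagrammatic.one (n : ℕ) : IsDiagrammatic (1 : Op p n n) := ⟨.id n, rfl⟩

theorem scalarOp_mul_scalarOp (a b : ℂ) :
    (scalarOp a * scalarOp b : Op p 0 0) = scalarOp (a * b) := by
  ext
  exact Fintype.sum_unique fun _ : Basis p 0 => a * b

variable (p) in
/-- The scalars that are the interpretation of some diagram. -/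
def diagramScalars : Submonoid ℂ where
  carrier := {z | IsDiagrammatic (scalarOp z : Op p 0 0)}
  one_mem' := ⟨.id 0, onesOp_zero_zero.symm⟩
  mul_mem' {a b} ha hb :=
    (congrArg IsDiagrammatic (scalarOp_mul_scalarOp a b)).mp (IsDiagrammatic.comp ha hb)

theorem mem_diagramScalars_iff {z : ℂ} :
    z ∈ diagramScalars p ↔ IsDiagrammatic (scalarOp z : Op p 0 0) := Iff.rfl

theorem greenOp_one_zero_mul_apply (a b : ZMod p) (M : Op p 0 1) :
    greenOp 1 0 a b * M = scalarOp (∑ k, spiderPhase a b k * M (fun _ => k) 0) := by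
  ext x y
  rw [Subsingleton.elim y 0, Matrix.mul_apply, sum_basis_one]
  refine sum_congr rfl fun k _ => ?_
  rw [greenOp_one_left_apply, if_pos (Subsingleton.elim _ _)]

theorem sum_spiderPhase_mem_diagramScalars (a b : ZMod p) :
    ∑ k, spiderPhase a b k ∈ diagramScalars p := by
  refine ⟨.comp (.greenUnit 0 0) (.greenCounit a b), (greenOp_one_zero_mul_apply _ _ _).trans ?_⟩
  refine congrArg scalarOp (sum_congr rfl fun k _ => ?_)
  rw [interp, greenOp_one_right_apply, if_pos (Subsingleton.elim _ _), spiderPhase_zero_zero,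
    mul_one]

theorem spiderPhase_mul_mem_diagramScalars {a b c : ZMod p} {z : ℂ}
    (h : IsDiagrammatic (Matrix.single (fun _ => c) 0 z : Op p 0 1)) :
    spiderPhase a b c * z ∈ diagramScalars p := by
  have hcounit := IsDiagrammatic.comp ⟨.greenCounit a b, rfl⟩ h
  rw [interp, greenOp_one_zero_mul_apply] at hcounit
  simpa [mem_diagramScalars_iff, Matrix.single_apply, const_eq_iff] using hcounit

theorem isDiagrammatic_single_sqrtP (c : ZMod p) (hp : p ≠ 2) :
    IsDiagrammatic (Matrix.single (fun _ => c) 0 (sqrtP p) : Op p 0 1) := by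
  refine ⟨.redUnit (2 * c) 0, ?_⟩
  ext x y
  simp [interp, redOp_zero_right_apply, Matrix.single_apply, const_eq_iff, sub_eq_zero,
    Subsingleton.elim y 0, inv_mul_cancel_left₀ (zmod_two_ne_zero hp), ← sqrtP_mul_self (p := p),
    mul_div_cancel_right₀ _ sqrtP_ne_zero]

theorem redOp_two_one_mul_greenOp_one_two_apply_zero (x : Basis p 1) :
    ((redOp 2 1 0 0 : Op p 2 1) * (greenOp 1 2 0 0 : Op p 1 2)) x 0 =
      if x = 0 then (sqrtP p)⁻¹ else 0 := by
  have hnorm : (p : ℂ) / sqrtP p ^ 3 = (sqrtP p)⁻¹ := by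
    rw [← sqrtP_mul_self, pow_succ, sq,
      div_mul_cancel_left₀ (mul_ne_zero sqrtP_ne_zero sqrtP_ne_zero)]
  rw [greenOp_one_left_eq_funOp, mul_funOp_apply, redOp_zero_right_apply, hnorm]
  simp [funext_iff]

theorem IsDiagrammatic.single_zero_mul_inv_sqrtP {z : ℂ}
    (h : IsDiagrammatic (Matrix.single 0 0 z : Op p 0 1)) :
    IsDiagrammatic (Matrix.single 0 0 ((sqrtP p)⁻¹ * z) : Op p 0 1) := by
  have hred : IsDiagrammatic ((redOp 2 1 0 0 : Op p 2 1) * (greenOp 1 2 0 0 : Op p 1 2)) :=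
    ⟨.comp .greenComult .redMult, rfl⟩
  convert hred.comp h using 1
  ext x y
  rw [Subsingleton.elim y 0, Matrix.mul_single_apply_same,
    redOp_two_one_mul_greenOp_one_two_apply_zero]
  simp [Matrix.single_apply, eq_comm]

theorem isDiagrammatic_scalarOp (hp : p ≠ 2) {c : ℂ} (hc : c ∈ scalars p) :
    IsDiagrammatic (scalarOp c : Op p 0 0) := by
  have h_two := zmod_two_ne_zero hp
  have h_gauss := sum_spiderPhase_mem_diagramScalars (p := p) 0 2
  have h_neg : -1 ∈ diagramScalars p := ⟨.star, rfl⟩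
  have h_zero : 0 ∈ diagramScalars p := by
    have h := sum_omegaPow_mul (1 : ZMod p)
    rw [if_neg one_ne_zero] at h
    simpa [spiderPhase, inv_mul_cancel_left₀ h_two, ← h] using
      sum_spiderPhase_mem_diagramScalars (p := p) 2 0
  have h_omega_sqrtP (a : ZMod p) : omegaPow p a * sqrtP p ∈ diagramScalars p := by
    have h := spiderPhase_mul_mem_diagramScalars (a := 2 * a) (b := 0)
      (isDiagrammatic_single_sqrtP 1 hp)
    rwa [spiderPhase, zero_mul, add_zero, mul_one, inv_mul_cancel_left₀ h_two] at h
  have h_sqrtP : sqrtP p ∈ diagramScalars p := by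
    simpa [omegaPow_zero] using h_omega_sqrtP 0
  have h_inv : (sqrtP p)⁻¹ ∈ diagramScalars p := by
    have h := (isDiagrammatic_single_sqrtP 0 hp).single_zero_mul_inv_sqrtP.single_zero_mul_inv_sqrtP
    simpa [spiderPhase_zero_zero, sqrtP_ne_zero] using
      spiderPhase_mul_mem_diagramScalars (a := 0) (b := 0) h
  have h_unit : phaseUnit p ∈ diagramScalars p := by
    have h := mul_mem h_gauss h_inv
    simp only [spiderPhase, zero_mul, zero_add, inv_mul_cancel_left₀ h_two] at h
    rcases sum_omegaPow_mul_sq_eq_or hp one_ne_zero with h' | h' <;>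
      simp only [one_mul] at h' <;> rw [h'] at h
    · simpa [sqrtP_ne_zero] using h
    · simpa [sqrtP_ne_zero] using mul_mem h_neg h
  refine scalars_le h_zero h_sqrtP h_inv h_unit (fun a => ?_) hc
  simpa [sqrtP_ne_zero] using mul_mem (h_omega_sqrtP a) h_inv

end Diagrammatic

section DiagramPhases

variable {p : ℕ}

theorem tensorOp_funOp {m n m' n' : ℕ} (g : Basis p m → Basis p n) (h : Basis p m' → Basis p n') :
    tensorOp (funOp g) (funOp h) = funOp fun y => Fin.append (g fun i => y (Fin.castAdd m' i))
      (h fun i => y (Fin.natAdd m i)) :=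
  ext_append fun x x' y y' => by
    simp only [tensorOp_append, funOp, Matrix.of_apply, Fin.append_left, Fin.append_right,
      append_inj_iff, ite_and, mul_ite, mul_one, mul_zero]
    split_ifs <;> rfl

theorem funOp_id (n : ℕ) : (funOp id : Op p n n) = 1 := by
  ext x y
  rw [Matrix.one_apply]
  rfl

theorem tensorOp_phaseOp [Fact p.Prime] {m n : ℕ} (q : Basis p m → ZMod p)
    (r : Basis p n → ZMod p) : tensorOp (phaseOp q) (phaseOp r) =
      phaseOp fun y => q (fun i => y (Fin.castAdd n i)) + r (fun i => y (Fin.natAdd m i)) :=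
  ext_append fun x x' y y' => by
    simp only [tensorOp_append, phaseOp, Matrix.diagonal_apply, append_inj_iff, ite_and, mul_ite,
      ite_mul, zero_mul, mul_zero, Fin.append_left, Fin.append_right, omegaPow_add]
    split_ifs <;> rfl

variable [Fact p.Prime]

variable (p) in
/-- The functions `q` of the computational basis labels whose phase operator
`∑_y ω^{q(y)} |y⟩⟨y|` is the interpretation of some diagram. -/
def diagramPhases (n : ℕ) : AddSubmonoid (Basis p n → ZMod p) where
  carrier := {q | IsDiagrammatic (phaseOp q)}
  zero_mem' := ⟨.id n, (phaseOp_zero n).symm⟩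
  add_mem' {q r} hq hr := by
    have h : phaseOp q * phaseOp r = phaseOp (q + r) := by
      simp only [phaseOp, Matrix.diagonal_mul_diagonal, ← omegaPow_add, Pi.add_apply]
    exact (congrArg IsDiagrammatic h).mp (IsDiagrammatic.comp hq hr)

theorem add_mem_diagramPhases {m n : ℕ} {q : Basis p m → ZMod p} {r : Basis p n → ZMod p}
    (hq : q ∈ diagramPhases p m) (hr : r ∈ diagramPhases p n) :
    (fun y => q (fun i => y (Fin.castAdd n i)) + r (fun i => y (Fin.natAdd m i))) ∈
      diagramPhases p (m + n) :=
  (congrArg IsDiagrammatic (tensorOp_phaseOp q r)).mp (IsDiagrammatic.tensor hq hr)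

theorem comp_castAdd_mem_diagramPhases {m : ℕ} (n : ℕ) {q : Basis p m → ZMod p}
    (hq : q ∈ diagramPhases p m) :
    (fun y => q fun i => y (Fin.castAdd n i)) ∈ diagramPhases p (m + n) := by
  simpa only [Pi.zero_apply, add_zero] using add_mem_diagramPhases hq (zero_mem (diagramPhases p n))

theorem comp_natAdd_mem_diagramPhases {n : ℕ} (m : ℕ) {q : Basis p n → ZMod p}
    (hq : q ∈ diagramPhases p n) :
    (fun y => q fun i => y (Fin.natAdd m i)) ∈ diagramPhases p (m + n) := by
  simpa only [Pi.zero_apply, zero_add] using add_mem_diagramPhases (zero_mem (diagramPhases p m)) hq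

theorem comp_swap_mem_diagramPhases {n : ℕ} {q : Basis p (n + 2) → ZMod p}
    (hq : q ∈ diagramPhases p (n + 2)) :
    (fun y => q (Fin.append (fun i => y (Fin.castAdd 2 i))
      ![y (Fin.natAdd n 1), y (Fin.natAdd n 0)])) ∈ diagramPhases p (n + 2) := by
  let s (y : Basis p (n + 2)) : Basis p (n + 2) := Fin.append (fun i => y (Fin.castAdd 2 i))
    ![y (Fin.natAdd n 1), y (Fin.natAdd n 0)]
  have hs (y) : s (s y) = y := by
    refine funext (Fin.addCases (fun i => ?_) (Fin.forall_fin_two.2 ⟨?_, ?_⟩)) <;>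
      simp only [s, Fin.append_left, Fin.append_right, Matrix.cons_val_zero, Matrix.cons_val_one]
  have hσ : IsDiagrammatic (funOp s) := by
    refine ⟨.tensor (.id n) .braid, ?_⟩
    rw [interp, interp, interp, swapOp_eq_funOp, ← funOp_id, tensorOp_funOp]
    rfl
  have hconj : funOp s * phaseOp q * funOp s = phaseOp fun y => q (s y) := by
    ext x y
    rw [mul_funOp_apply, phaseOp, Matrix.mul_diagonal, phaseOp, Matrix.diagonal_apply, funOp,
      Matrix.of_apply, hs, ite_mul, one_mul, zero_mul]
    exact ite_congr rfl (fun hxy => by rw [hxy]) fun _ => rfl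
  exact (congrArg IsDiagrammatic hconj).mp ((hσ.comp hq).comp hσ)

theorem spider_mem_diagramPhases (a b : ZMod p) :
    (fun y : Basis p 1 => 2⁻¹ * (a * y 0 + b * y 0 ^ 2)) ∈ diagramPhases p 1 := by
  refine ⟨.comp .greenComult (.tensor (.id 1) (.greenCounit a b)), ?_⟩
  ext x y
  simp only [interp, greenOp_one_left_eq_funOp, mul_funOp_apply, tensorOp, Matrix.of_apply,
    greenOp_one_left_apply, if_pos (Subsingleton.elim _ _), phaseOp, Matrix.one_apply,
    Matrix.diagonal_apply, const_eq_iff.2 (rfl : y 0 = y 0), ite_mul, one_mul, zero_mul]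
  exact ite_congr rfl (fun h => by rw [← h]; rfl) fun _ => rfl

theorem greenOp_mul_tensorOp_apply (M : Op p 1 1) (x y y' : Basis p 1) :
    ((greenOp 2 1 0 0 : Op p 2 1) * tensorOp M (1 : Op p 1 1)) x (Fin.append y y') =
      if x = y' then M x y else 0 := by
  have hx : (fun _ => x 0 : Basis p (1 + 1)) = Fin.append x x := by
    refine funext (Fin.addCases (fun i => ?_) fun i => ?_)
    · rw [Fin.append_left, Subsingleton.elim i 0]
    · rw [Fin.append_right, Subsingleton.elim i 0]
  simp only [Matrix.mul_apply, greenOp_one_right_apply, spiderPhase_zero_zero, ite_mul, one_mul,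
    zero_mul, sum_ite_eq, mem_univ, if_true]
  refine (congrArg (tensorOp M 1 · _) hx).trans ?_
  rw [tensorOp_append, Matrix.one_apply, mul_ite, mul_one, mul_zero]

theorem tensorOp_greenOp_one_two_one_eq_funOp :
    tensorOp (greenOp 1 2 0 0 : Op p 1 2) (1 : Op p 1 1) =
      (funOp fun y => Fin.append (fun _ => y 0) y : Op p (1 + 1) (1 + (1 + 1))) := by
  rw [greenOp_one_left_eq_funOp, ← funOp_id, tensorOp_funOp]
  refine congrArg funOp (funext fun y => funext fun i => ?_)
  fin_cases i <;> rfl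

theorem sqrtP_smul_tensorOp_mul_tensorOp :
    sqrtP p • (tensorOp (1 : Op p 1 1)
      ((greenOp 2 1 0 0 : Op p 2 1) * tensorOp (hadamardOp p) (1 : Op p 1 1)) *
        tensorOp (greenOp 1 2 0 0 : Op p 1 2) (1 : Op p 1 1) : Op p (1 + 1) (1 + 1)) =
      phaseOp fun y : Basis p (1 + 1) => y 0 * y 1 := by
  rw [tensorOp_greenOp_one_two_one_eq_funOp]
  refine ext_append fun x x' y y' => ?_
  rw [Matrix.smul_apply, mul_funOp_apply]
  have hy : (fun _ => Fin.append y y' 0) = y := funext fun i => by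
    rw [Subsingleton.elim i 0]
    rfl
  rw [hy, tensorOp_append, greenOp_mul_tensorOp_apply, Matrix.one_apply]
  simp only [phaseOp, Matrix.diagonal_apply, append_inj_iff, ite_and, ite_mul, one_mul, zero_mul,
    smul_ite, smul_zero]
  refine ite_congr rfl (fun h => ite_congr rfl (fun h' => ?_) fun _ => rfl) fun _ => rfl
  rw [h, h', hadamardOp, Matrix.of_apply, smul_eq_mul, mul_div_cancel₀ _ sqrtP_ne_zero,
    mul_comm (y' 0)]
  rfl

theorem mul_mem_diagramPhases (hp : p ≠ 2) :
    (fun y : Basis p (1 + 1) => y 0 * y 1) ∈ diagramPhases p (1 + 1) := by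
  have h_one : IsDiagrammatic (1 : Op p 1 1) := .one 1
  have h_mult : IsDiagrammatic (greenOp 2 1 0 0 : Op p 2 1) := ⟨.greenMult, rfl⟩
  have h_comult : IsDiagrammatic (greenOp 1 2 0 0 : Op p 1 2) := ⟨.greenComult, rfl⟩
  have h_hadamard : IsDiagrammatic (hadamardOp p) := ⟨.hadamard, interp_hadamard⟩
  have h := ((h_one.tensor (h_mult.comp (h_hadamard.tensor h_one))).comp
    (h_comult.tensor h_one)).tensor (isDiagrammatic_scalarOp hp sqrtP_mem_scalars)
  exact (congrArg IsDiagrammatic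
    ((tensorOp_scalarOp _ _).trans sqrtP_smul_tensorOp_mul_tensorOp)).mp h

theorem comp_apply_mem_diagramPhases {f : ZMod p → ZMod p}
    (hf : (fun y : Basis p 1 => f (y 0)) ∈ diagramPhases p 1) {n : ℕ} (i : Fin n) :
    (fun y : Basis p n => f (y i)) ∈ diagramPhases p n := by
  induction n with
  | zero => exact i.elim0
  | succ n ih =>
    cases i using Fin.lastCases with
    | last => exact comp_natAdd_mem_diagramPhases n hf
    | cast i => exact comp_castAdd_mem_diagramPhases 1 (ih i)

theorem apply_castSucc_mul_apply_last_mem_diagramPhases (hp : p ≠ 2) {n : ℕ} (i : Fin n) :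
    (fun y : Basis p (n + 1) => y i.castSucc * y (Fin.last n)) ∈ diagramPhases p (n + 1) := by
  induction n with
  | zero => exact i.elim0
  | succ n ih =>
    cases i using Fin.lastCases with
    | last => exact comp_natAdd_mem_diagramPhases n (mul_mem_diagramPhases hp)
    | cast i =>
      refine (congrArg (· ∈ diagramPhases p (n + 2)) (funext fun y => ?_)).mp
        (comp_swap_mem_diagramPhases (comp_castAdd_mem_diagramPhases 1 (ih i)))
      exact congrArg₂ (· * ·) (Fin.append_left (fun i => y (Fin.castAdd 2 i)) _ i)
        (Fin.append_right (fun i => y (Fin.castAdd 2 i)) _ (0 : Fin 2))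

theorem apply_mul_apply_mem_diagramPhases (hp : p ≠ 2) {n : ℕ} (i j : Fin n) :
    (fun y : Basis p n => y i * y j) ∈ diagramPhases p n := by
  induction n with
  | zero => exact i.elim0
  | succ n ih =>
    cases i using Fin.lastCases with
    | last =>
      cases j using Fin.lastCases with
      | last =>
        have h := spider_mem_diagramPhases (p := p) 0 2
        simp only [zero_mul, zero_add, inv_mul_cancel_left₀ (zmod_two_ne_zero hp), sq] at h
        exact comp_apply_mem_diagramPhases (f := fun k => k * k) h (Fin.last n)
      | cast j => simpa only [mul_comm] using
          apply_castSucc_mul_apply_last_mem_diagramPhases hp j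
    | cast i =>
      cases j using Fin.lastCases with
      | last => exact apply_castSucc_mul_apply_last_mem_diagramPhases hp i
      | cast j => exact comp_castAdd_mem_diagramPhases 1 (ih i j)

theorem const_mul_mem_diagramPhases (a : ZMod p) {n : ℕ} {q : Basis p n → ZMod p}
    (hq : q ∈ diagramPhases p n) : (fun y => a * q y) ∈ diagramPhases p n := by
  have h := nsmul_mem hq a.val
  simpa only [nsmul_eq_mul, ZMod.natCast_zmod_val, Pi.smul_def] using h

theorem const_mem_diagramPhases (hp : p ≠ 2) (c : ZMod p) (n : ℕ) :
    (fun _ => c) ∈ diagramPhases p n := by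
  have h : tensorOp (1 : Op p n n) (scalarOp (omegaPow p c) : Op p 0 0) = phaseOp fun _ => c := by
    rw [tensorOp_scalarOp, ← Matrix.diagonal_one, ← Matrix.diagonal_smul]
    simp only [Pi.smul_def, smul_eq_mul, mul_one]
    rfl
  exact (congrArg IsDiagrammatic h).mp ((IsDiagrammatic.one n).tensor
    (isDiagrammatic_scalarOp hp (omegaPow_mem_scalars c)))

theorem apply_mem_diagramPhases (hp : p ≠ 2) {n : ℕ} (i : Fin n) :
    (fun y : Basis p n => y i) ∈ diagramPhases p n := by
  have h := spider_mem_diagramPhases (p := p) 2 0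
  simp only [zero_mul, add_zero, inv_mul_cancel_left₀ (zmod_two_ne_zero hp)] at h
  exact comp_apply_mem_diagramPhases (f := id) h i

theorem IsQuadratic.mem_diagramPhases (hp : p ≠ 2) {n : ℕ} {q : Basis p n → ZMod p}
    (hq : IsQuadratic q) : q ∈ diagramPhases p n := by
  obtain ⟨Q, l, c, h⟩ := hq
  obtain ⟨B, rfl⟩ := LinearMap.BilinMap.toQuadraticMap_surjective Q
  let e (i j : Fin n) : ZMod p := if i = j then 1 else 0
  have hl (y : Basis p n) : l y = ∑ i, l (e i) * y i := by
    simp only [LinearMap.pi_apply_eq_sum_univ l y, smul_eq_mul, mul_comm, e]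
  have hB (y : Basis p n) : B y y = ∑ i, ∑ j, B (e i) (e j) * (y i * y j) := by
    rw [LinearMap.pi_apply_eq_sum_univ B y, LinearMap.sum_apply]
    refine sum_congr rfl fun i _ => ?_
    rw [LinearMap.smul_apply, LinearMap.pi_apply_eq_sum_univ (B _) y, smul_sum]
    refine sum_congr rfl fun j _ => ?_
    rw [smul_eq_mul, smul_eq_mul]
    ring
  have hq : q = (∑ i, ∑ j, fun y => B (e i) (e j) * (y i * y j)) +
      (∑ i, fun y => l (e i) * y i) + fun _ => c := by
    ext y
    rw [h, LinearMap.BilinMap.toQuadraticMap_apply, hB, hl]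
    simp only [Pi.add_apply, Finset.sum_apply]
  rw [hq]
  exact add_mem (add_mem
    (sum_mem fun i _ => sum_mem fun j _ =>
      const_mul_mem_diagramPhases _ (apply_mul_apply_mem_diagramPhases hp i j))
    (sum_mem fun i _ => const_mul_mem_diagramPhases _ (apply_mem_diagramPhases hp i)))
    (const_mem_diagramPhases hp c n)

theorem IsGaussianOp.isDiagrammatic (hp : p ≠ 2) {m n : ℕ} {M : Op p m n} (hM : IsGaussianOp M) :
    IsDiagrammatic M := by
  have h_state : IsDiagrammatic (onesOp p 0 1) := by
    refine ⟨.greenUnit 0 0, ?_⟩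
    ext x y
    rw [interp, greenOp_one_right_apply, if_pos (Subsingleton.elim _ _), spiderPhase_zero_zero]
    rfl
  have h_effect : IsDiagrammatic (onesOp p 1 0) := by
    refine ⟨.greenCounit 0 0, ?_⟩
    ext x y
    rw [interp, greenOp_one_left_apply, if_pos (Subsingleton.elim _ _), spiderPhase_zero_zero]
    rfl
  exact hM.induction (P := IsDiagrammatic) .comp .tensor (isDiagrammatic_scalarOp hp)
    (IsQuadratic.mem_diagramPhases hp) h_state h_effect

end DiagramPhases

end QupitZX

end

theorem mainTheorem7 (p : ℕ) [Fact p.Prime] (hp : p ≠ 2) :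
    (∀ (m n : ℕ) (D : QupitZX.Diagram p m n),
      QupitZX.IsStabiliserOperation (QupitZX.interp D)) ∧
    (∀ (m n : ℕ) (C : QupitZX.Op p m n), QupitZX.IsStabiliserOperation C →
      ∃ D : QupitZX.Diagram p m n, QupitZX.interp D = C) := by
  simp only [QupitZX.isStabiliserOperation_iff_isGaussianOp hp]
  exact ⟨fun _ _ => QupitZX.isGaussianOp_interp, fun _ _ _ hC => hC.isDiagrammatic hp⟩
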